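/- Let $(M,g)$ be a complete connected smooth Riemannian manifold (without boundary) of dimension $m$, with Riemannian volume measure $dv$ and scalar curvature $R$. For a bounded open set $U\subset M$, a smooth function $a$ on $M$ and $\tau>0$, let $\mathscr S(U)$ be the set of nonnegative $\varphi\in W^{1,2}_0(U)$ with $\int_U\varphi^2\,dv=1$, and put $$\mathcal W^{(a)}(U,\varphi,\tau)=-m-\frac m2\log(4\pi\tau)+\int_U\left\{\tau\left(a\varphi^2+4|\nabla\varphi|^2\right)-2\varphi^2\log\varphi\right\}dv,$$ $$\mu^{(a)}(U,\tau)=\inf_{\varphi\in\mathscr S(U)}\mathcal W^{(a)}(U,\varphi,\tau),\qquad \nu^{(a)}(U,\tau)=\inf_{0<s\le\tau}\mu^{(a)}(U,s).$$ Write $\nu=\nu^{(R)}$ and $\bar\nu=\nu^{(0)}$. Let $\Omega\subset M$ and let $\bar\Lambda\ge 0$ be a constant such that $R\le\bar\Lambda$ on $\Omega$. Let $x_0\in M$ and $r_0>0$ be such that the open geodesic ball $B=B(x_0,r_0)$ is contained in $\Omega$. Then, with $\bar\nu=\bar\nu(B,r_0^2)$, $\nu=\nu(B,r_0^2)$, $|B|=\int_B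 dv$, and $\omega_m$ the volume of the unit ball of $\mathbb R^m$, $$\frac{|B|}{\omega_m r_0^m}\ \ge\ e^{\bar\nu-2^{m+7}}\ \ge\ e^{\nu-2^{m+7}-\bar\Lambda r_0^2}.$$ -/

import Mathlib

open scoped Manifold ContDiff ENNReal Topology
open MeasureTheory Filter Bundle

noncomputable section

/-- The model space `ℝ^m`. -/
abbrev Em (m : ℕ) : Type := EuclideanSpace ℝ (Fin m)

section Geometry

variable (m : ℕ) {M : Type*} [TopologicalSpace M] [ChartedSpace (Em m) M]
  [RiemannianBundle (fun x : M => TangentSpace (𝓡 m) x)]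

/-- The partial derivative `∂_i f` of a function on `ℝ^m`. -/
def partialDeriv (i : Fin m) (f : Em m → ℝ) (y : Em m) : ℝ :=
  fderiv ℝ f y (EuclideanSpace.single i 1)

/-- The coordinate vector field `∂_i` of the preferred chart at `p`, at the point with
coordinates `y`. -/
def coordField (p : M) (y : Em m) (i : Fin m) :
    TangentSpace (𝓡 m) ((extChartAt (𝓡 m) p).symm y) :=
  mfderiv 𝓘(ℝ, Em m) (𝓡 m) (extChartAt (𝓡 m) p).symm y (EuclideanSpace.single i (1 : ℝ))

/-- The matrix `g_{ij} = ⟨∂_i, ∂_j⟩` of the metric in the preferred chart at `p`, as a function of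
the coordinates `y`. -/
def metricMatrix (p : M) (y : Em m) : Matrix (Fin m) (Fin m) ℝ :=
  Matrix.of fun i j => inner ℝ (coordField m p y i) (coordField m p y j)

/-- Christoffel symbols
`Γ^k_{ij} = (1/2) ∑_l g^{kl} (∂_i g_{jl} + ∂_j g_{il} - ∂_l g_{ij})` in the chart at `p`. -/
def christoffel (p : M) (k i j : Fin m) (y : Em m) : ℝ :=
  (1 / 2) * ∑ l, (metricMatrix m p y)⁻¹ k l *
    (partialDeriv m i (fun z => metricMatrix m p z j l) y
      + partialDeriv m j (fun z => metricMatrix m p z i l) y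
      - partialDeriv m l (fun z => metricMatrix m p z i j) y)

/-- Ricci curvature in the chart at `p`:
`R_{ij} = ∑_k (∂_k Γ^k_{ij} - ∂_j Γ^k_{ik}) + ∑_{k,l} (Γ^k_{kl} Γ^l_{ij} - Γ^k_{jl} Γ^l_{ik})`. -/
def ricciCoord (p : M) (i j : Fin m) (y : Em m) : ℝ :=
  ∑ k, (partialDeriv m k (christoffel m p k i j) y - partialDeriv m j (christoffel m p k i k) y)
    + ∑ k, ∑ l, (christoffel m p k k l y * christoffel m p l i j y
        - christoffel m p k j l y * christoffel m p l i k y)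

/-- Scalar curvature `R = ∑_{i,j} g^{ij} R_{ij}` at the point `p`, computed in the preferred chart
at `p` (the round unit sphere has `R = m (m - 1)`). -/
def scalarCurvature (p : M) : ℝ :=
  ∑ i, ∑ j, (metricMatrix m p (extChartAt (𝓡 m) p p))⁻¹ i j *
    ricciCoord m p i j (extChartAt (𝓡 m) p p)

variable [MeasurableSpace M]

/-- The measure `√(det g_{ij}) dy` carried by the domain of the preferred chart at `p`, as a
measure on `M`. -/
def chartVolume (p : M) : Measure M :=
  Measure.map (extChartAt (𝓡 m) p).symm
    ((volume.restrict (extChartAt (𝓡 m) p).target).withDensity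
      fun y => ENNReal.ofReal (Real.sqrt (metricMatrix m p y).det))

variable (M) in
/-- The Riemannian volume measure `dv`: the least measure that dominates `√(det g_{ij}) dy` on
each preferred coordinate domain. (As these agree on overlaps, on a second countable manifold it
is the measure that equals `√(det g_{ij}) dy` in every chart.) -/
def riemannianVolume : Measure M := ⨆ p : M, chartVolume m p

end Geometry

section Functionals

variable (m : ℕ) {M : Type*} [TopologicalSpace M] [ChartedSpace (Em m) M]
  [RiemannianBundle (fun x : M => TangentSpace (𝓡 m) x)] [MeasurableSpace M]

/-- `φ ∈ W_0^{1,2}(Ω)` with differential `dφ`: in the `W^{1,2}(Ω)` norm, `(φ, dφ)` is the limit of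
`(ψ_k, dψ_k)` for functions `ψ_k ∈ C_c^∞(Ω)`. The norm of a covector is dual to the norm `g_x`, so
`‖dφ x‖ = |∇φ|(x)`. The field `dφ` is determined by `φ` up to a null set. -/
def MemW012 (Ω : Set M) (φ : M → ℝ) (dφ : (x : M) → (TangentSpace (𝓡 m) x →L[ℝ] ℝ)) : Prop :=
  MemLp φ 2 ((riemannianVolume m M).restrict Ω) ∧
  ∃ ψ : ℕ → M → ℝ,
    (∀ k, ContMDiff (𝓡 m) 𝓘(ℝ, ℝ) ∞ (ψ k) ∧ HasCompactSupport (ψ k) ∧ tsupport (ψ k) ⊆ Ω) ∧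
    (∀ k, AEStronglyMeasurable (fun x => ‖mvfderiv (𝓡 m) (ψ k) x - dφ x‖)
      ((riemannianVolume m M).restrict Ω)) ∧
    Tendsto (fun k => eLpNorm (fun x => ψ k x - φ x) 2 ((riemannianVolume m M).restrict Ω))
      atTop (𝓝 0) ∧
    Tendsto (fun k => eLpNorm (fun x => ‖mvfderiv (𝓡 m) (ψ k) x - dφ x‖) 2
      ((riemannianVolume m M).restrict Ω)) atTop (𝓝 0)

/-- The class `𝒮(Ω)`: nonnegative `φ ∈ W_0^{1,2}(Ω)` with `∫_Ω φ² dv = 1` (together with `dφ`). -/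
def Admissible (Ω : Set M) (φ : M → ℝ) (dφ : (x : M) → (TangentSpace (𝓡 m) x →L[ℝ] ℝ)) : Prop :=
  MemW012 m Ω φ dφ ∧ (∀ᵐ x ∂((riemannianVolume m M).restrict Ω), 0 ≤ φ x) ∧
    ∫ x in Ω, (φ x) ^ 2 ∂(riemannianVolume m M) = 1

/-- The Lebesgue integral `∫ f⁺ - ∫ f⁻` with values in `[-∞, ∞]`. -/
def extIntegral {X : Type*} [MeasurableSpace X] (μ : Measure X) (f : X → ℝ) : EReal :=
  ((∫⁻ x, ENNReal.ofReal (f x) ∂μ : ℝ≥0∞) : EReal)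
    - ((∫⁻ x, ENNReal.ofReal (-f x) ∂μ : ℝ≥0∞) : EReal)

/-- `𝒲^{(a)}(Ω, g, φ, τ) = -m - (m/2) log (4πτ) + ∫_Ω {τ (a φ² + 4|∇φ|²) - 2 φ² log φ} dv`. -/
def WFunctional (a : M → ℝ) (Ω : Set M) (φ : M → ℝ)
    (dφ : (x : M) → (TangentSpace (𝓡 m) x →L[ℝ] ℝ)) (τ : ℝ) : EReal :=
  ((-(m : ℝ) - (m : ℝ) / 2 * Real.log (4 * Real.pi * τ) : ℝ) : EReal)
    + extIntegral ((riemannianVolume m M).restrict Ω) fun x =>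
        τ * (a x * (φ x) ^ 2 + 4 * ‖dφ x‖ ^ 2) - 2 * (φ x) ^ 2 * Real.log (φ x)

/-- `μ^{(a)}(Ω, g, τ) = inf_{φ ∈ 𝒮(Ω)} 𝒲^{(a)}(Ω, g, φ, τ)`. -/
def muFunctional (a : M → ℝ) (Ω : Set M) (τ : ℝ) : EReal :=
  ⨅ (φ : M → ℝ) (dφ : (x : M) → (TangentSpace (𝓡 m) x →L[ℝ] ℝ)) (_ : Admissible m Ω φ dφ),
    WFunctional m a Ω φ dφ τ

/-- `ν^{(a)}(Ω, g, τ) = inf_{0 < s ≤ τ} μ^{(a)}(Ω, g, s)`. -/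
def nuFunctional (a : M → ℝ) (Ω : Set M) (τ : ℝ) : EReal :=
  ⨅ s ∈ Set.Ioc 0 τ, muFunctional m a Ω s

/-- `ν(Ω, g, τ)`, the case `a = R`. -/
def nu (Ω : Set M) (τ : ℝ) : EReal := nuFunctional m (fun x : M => scalarCurvature m x) Ω τ

/-- `ν̄(Ω, g, τ)`, the case `a = 0`. -/
def nuBar (Ω : Set M) (τ : ℝ) : EReal := nuFunctional m (fun _ : M => (0 : ℝ)) Ω τ

end Functionals

/-- `ω_m`, the volume of the unit ball of Euclidean `ℝ^m`. -/
def omegaBall (m : ℕ) : ℝ≥0∞ := volume (Metric.ball (0 : Em m) 1)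

end

/-!
The second inequality holds because `R ≤ Λbar` on the ball: for an admissible `φ` and `s ≤ r₀²` the
functional with `a = R` exceeds the one with `a = 0` by at most `s Λbar ∫ φ² ≤ Λbar r₀²`
(`nu_le_nuBar_add`). The integrals are extended integrals, so this uses the measurability of `|∇φ|`,
which follows from the continuity of `|∇ψ|` for smooth `ψ` (`continuous_norm_mvfderiv`).

For the first inequality, let `V r` be the volume of the ball of radius `r` around `x₀`, and test the
entropy at time `r²`, for `r ≤ r₀`, with the normalization of a cutoff function on that ball. The
gradient term is at most `100 V(r) / V(r/2)`, and by Jensen's inequality the logarithmic term is at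
most `log V(r)`. Hence, with `Q r = V r / (ω_m r^m)`,
`ν̄ ≤ log (Q r) + 100 V(r) / V(r/2)` (`nuBar_le_log_volume_add`, and `ω_m ≤ 2^m`). If the claim failed
at `r₀`, then `V(r) / V(r/2) > (128 / 100) 2^m` at `r = r₀`, so that `Q (r₀/2) ≤ (100/128) Q r₀`, and
the claim would fail at `r₀/2` as well. By iteration `Q (r₀/2^k) → 0`, which contradicts the lower
bound `V r ≥ c r^m` for small `r` (`exists_eventually_le_riemannianVolume_ball`); see
`le_log_volume_ratio_add`. A ball of infinite volume satisfies the inequality trivially.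

The distance function is not smooth, while the class `W₀^{1,2}` is defined by smooth functions with
compact support. The cutoff function is therefore a smooth approximation of the tent function
`max 0 (7r/8 - d(x₀, ·))` with gradient at most `5/4` (`exists_contMDiff_approx_of_lipschitz`). Near
each point the metric is almost constant in a chart, so that mollification in the chart almost
preserves the Lipschitz constant, and the local approximations are glued by a partition of unity. The
support is compact because closed balls in a complete Riemannian manifold are compact
(`properSpace_of_isRiemannianManifold`).
-/

theorem isContinuousRiemannianBundle_tangentSpace (m : ℕ) (M : Type*) [TopologicalSpace M]
    [ChartedSpace (Em m) M] [IsManifold (𝓡 m) ∞ M]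
    [RiemannianBundle (fun x : M => TangentSpace (𝓡 m) x)]
    [h : IsContMDiffRiemannianBundle (𝓡 m) ∞ (Em m) (fun x : M => TangentSpace (𝓡 m) x)] :
    IsContinuousRiemannianBundle (Em m) (fun x : M => TangentSpace (𝓡 m) x) := by
  obtain ⟨g, hg, hg'⟩ := h.exists_contMDiff
  exact ⟨g, hg.continuous, hg'⟩

section RiemannianManifold

variable {m : ℕ} {M : Type*} [MetricSpace M] [ChartedSpace (Em m) M]
    [RiemannianBundle (fun x : M => TangentSpace (𝓡 m) x)]

/-! ### Bounded closed sets are compact -/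

variable (m) in
/-- A Riemannian manifold is a length space: a distance less than `a + b` can be split into a part
of length at most `a` and a part of length at most `b`. -/
theorem exists_dist_le_and_dist_le_of_dist_lt_add [IsRiemannianManifold (𝓡 m) M]
    {x z : M} {a b : ℝ} (ha : 0 ≤ a) (hb : 0 ≤ b) (h : dist x z < a + b) :
    ∃ y, dist x y ≤ a ∧ dist y z ≤ b := by
  rcases le_or_gt (dist x z) a with hxz | hxz
  · exact ⟨z, hxz, by simpa using hb⟩
  have h1 : Manifold.riemannianEDist (𝓡 m) x z < ENNReal.ofReal (a + b) := by
    rw [← IsRiemannianManifold.out, edist_dist]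
    exact (ENNReal.ofReal_lt_ofReal_iff_of_nonneg dist_nonneg).2 h
  obtain ⟨γ, h0, h1', hγ, hlen, -, -⟩ :=
    Manifold.exists_lt_locally_constant_of_riemannianEDist_lt h1 zero_lt_one
  have hcont : ContinuousOn (fun t => dist x (γ t)) (Set.Icc 0 1) :=
    (continuous_const.dist hγ.continuous).continuousOn
  obtain ⟨t, ht, hta⟩ : a ∈ (fun t => dist x (γ t)) '' Set.Icc 0 1 := by
    apply intermediate_value_Icc zero_le_one hcont
    simp [h0, h1', ha, hxz.le]
  refine ⟨γ t, hta.le, ?_⟩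
  have e1 : ENNReal.ofReal a ≤ Manifold.pathELength (𝓡 m) γ 0 t := by
    rw [← hta, ← edist_dist, IsRiemannianManifold.out (I := 𝓡 m)]
    exact Manifold.riemannianEDist_le_pathELength hγ.contMDiffOn h0 rfl ht.1
  have e2 : edist (γ t) z ≤ Manifold.pathELength (𝓡 m) γ t 1 := by
    rw [IsRiemannianManifold.out (I := 𝓡 m)]
    exact Manifold.riemannianEDist_le_pathELength hγ.contMDiffOn rfl h1' ht.2
  rw [← Manifold.pathELength_add ht.1 ht.2, ENNReal.ofReal_add ha hb] at hlen
  by_contra! hcon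
  refine absurd hlen (not_lt.2 (add_le_add e1 (le_trans ?_ e2)))
  rw [edist_dist]
  exact ENNReal.ofReal_le_ofReal hcon.le

variable (m) in
/-- The compactness part of the Hopf–Rinow theorem, by the argument of Cohn-Vossen: the set of radii
of compact closed balls around a point is both closed and open. -/
theorem properSpace_of_isRiemannianManifold [IsRiemannianManifold (𝓡 m) M] [CompleteSpace M] :
    ProperSpace M := by
  have : LocallyCompactSpace M := ChartedSpace.locallyCompactSpace (Em m) M
  refine ProperSpace.of_isCompact_closedBall_of_le 0 fun x r₁ hr₁ => ?_
  by_contra hcon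
  set S := {r : ℝ | 0 ≤ r ∧ IsCompact (Metric.closedBall x r)} with hS
  have hmono : ∀ r ∈ S, ∀ s ≤ r, IsCompact (Metric.closedBall x s) := fun r hr s hs =>
    hr.2.of_isClosed_subset Metric.isClosed_closedBall (Metric.closedBall_subset_closedBall hs)
  have h0 : (0 : ℝ) ∈ S := ⟨le_rfl, by simp⟩
  have hbdd : BddAbove S := by
    refine ⟨r₁, fun r hr => ?_⟩
    by_contra! hlt
    exact hcon (hmono r hr r₁ hlt.le)
  set R := sSup S with hR
  have hR0 : 0 ≤ R := le_csSup hbdd h0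
  have hRS : R ∈ S := by
    refine ⟨hR0, TotallyBounded.isCompact_of_isClosed (Metric.totallyBounded_iff.2 fun ε hε => ?_)
      Metric.isClosed_closedBall⟩
    obtain ⟨r, hr, hlt⟩ := exists_lt_of_lt_csSup ⟨0, h0⟩ (show R - ε / 2 < sSup S by linarith)
    obtain ⟨t, ht, hcov⟩ := Metric.totallyBounded_iff.1 hr.2.totallyBounded (ε / 2) (half_pos hε)
    refine ⟨t, ht, fun z hz => ?_⟩
    obtain ⟨y, hy, hyz⟩ := exists_dist_le_and_dist_le_of_dist_lt_add m (x := x) (z := z) hr.1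
      (half_pos hε).le (by rw [dist_comm]; linarith [Metric.mem_closedBall.1 hz])
    obtain ⟨c, hc, hyc⟩ := Set.mem_iUnion₂.1 (hcov (Metric.mem_closedBall'.2 hy))
    refine Set.mem_iUnion₂.2 ⟨c, hc, ?_⟩
    rw [Metric.mem_ball] at hyc ⊢
    linarith [dist_triangle z y c, dist_comm z y]
  obtain ⟨δ, hδ, hcpt⟩ := hRS.2.exists_isCompact_cthickening
  have hmem : R + δ / 2 ∈ S := by
    refine ⟨by positivity, hcpt.of_isClosed_subset Metric.isClosed_closedBall fun z hz => ?_⟩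
    obtain ⟨y, hy, hyz⟩ := exists_dist_le_and_dist_le_of_dist_lt_add m (x := x) (z := z) hR0
      hδ.le (by rw [dist_comm]; linarith [Metric.mem_closedBall.1 hz])
    exact Metric.mem_cthickening_of_dist_le z y δ _ (Metric.mem_closedBall'.2 hy)
      (by rwa [dist_comm])
  linarith [le_csSup hbdd hmem]

/-! ### Comparison of the metric with a chart -/

variable [IsManifold (𝓡 m) ∞ M]

variable (m) in
/-- The inverse of the chart at `p`, differentiated at the centre: it identifies the model space
with the tangent space at `p`, and so carries the norm of the latter over to the coordinates. -/
noncomputable abbrev chartFrame (p : M) : Em m →L[ℝ] TangentSpace (𝓡 m) p :=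
  (trivializationAt (Em m) (TangentSpace (𝓡 m)) p).symmL ℝ p

variable [IsContinuousRiemannianBundle (Em m) (fun x : M => TangentSpace (𝓡 m) x)]

theorem eventually_norm_chartFrame_mfderiv_le (p : M) {r : ℝ} (hr : 1 < r) :
    ∀ᶠ x in 𝓝 p, ∀ v : TangentSpace (𝓡 m) x,
      ‖chartFrame m p (mfderiv (𝓡 m) 𝓘(ℝ, Em m) (extChartAt (𝓡 m) p) x v)‖ ≤ r * ‖v‖ := by
  filter_upwards [eventually_norm_symmL_trivializationAt_self_comp_lt (Em m)
    (fun x : M => TangentSpace (𝓡 m) x) p hr, chart_source_mem_nhds (Em m) p] with x hx hxs v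
  have h := ((trivializationAt (Em m) (TangentSpace (𝓡 m)) p).symmL ℝ p ∘SL
    (trivializationAt (Em m) (TangentSpace (𝓡 m)) p).continuousLinearMapAt ℝ x).le_of_opNorm_le
    hx.le v
  rw [TangentBundle.continuousLinearMapAt_trivializationAt hxs] at h
  exact h

theorem eventually_norm_mfderiv_extChartAt_symm_le (p : M) {r : ℝ} (hr : 1 < r) :
    ∀ᶠ x in 𝓝 p, ∀ w : Em m,
      ‖mfderiv 𝓘(ℝ, Em m) (𝓡 m) (extChartAt (𝓡 m) p).symm (extChartAt (𝓡 m) p x) w‖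
        ≤ r * ‖chartFrame m p w‖ := by
  filter_upwards [eventually_norm_symmL_trivializationAt_comp_self_lt (Em m)
    (fun x : M => TangentSpace (𝓡 m) x) p hr, chart_source_mem_nhds (Em m) p] with x hx hxs w
  have h := ((trivializationAt (Em m) (TangentSpace (𝓡 m)) p).symmL ℝ x ∘SL
    (trivializationAt (Em m) (TangentSpace (𝓡 m)) p).continuousLinearMapAt ℝ p).le_of_opNorm_le
    hx.le (chartFrame m p w)
  have hp : p ∈ (trivializationAt (Em m) (TangentSpace (𝓡 m)) p).baseSet :=
    FiberBundle.mem_baseSet_trivializationAt' p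
  rw [ContinuousLinearMap.comp_apply,
    Trivialization.continuousLinearMapAt_symmL _ hp, TangentBundle.symmL_trivializationAt hxs] at h
  have A : (extChartAt (𝓡 m) p).symm (extChartAt (𝓡 m) p x) = x :=
    (extChartAt (𝓡 m) p).left_inv (by simpa using hxs)
  rw [← mfderivWithin_univ, ← ModelWithCorners.Boundaryless.range_eq_univ (I := 𝓡 m)]
  convert! h using 2
  congr

end RiemannianManifold

section ChartDistance

variable {m : ℕ} {M : Type*} [MetricSpace M] [ChartedSpace (Em m) M] [IsManifold (𝓡 m) ∞ M]
    [RiemannianBundle (fun x : M => TangentSpace (𝓡 m) x)]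
    [IsContinuousRiemannianBundle (Em m) (fun x : M => TangentSpace (𝓡 m) x)]

/-- On a small coordinate ball around `p`, the metric is `r`-close to the constant metric
`‖chartFrame m p ·‖`: the differential of the chart and the distance between two points of the ball
are both compared with it. -/
theorem exists_chart_ball_comparison [IsRiemannianManifold (𝓡 m) M] (p : M) {r : ℝ} (hr : 1 < r) :
    ∃ ρ > 0, Metric.closedBall (extChartAt (𝓡 m) p p) ρ ⊆ (extChartAt (𝓡 m) p).target ∧
      (∀ x ∈ (extChartAt (𝓡 m) p).source,
        extChartAt (𝓡 m) p x ∈ Metric.closedBall (extChartAt (𝓡 m) p p) ρ →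
        ∀ v : TangentSpace (𝓡 m) x,
        ‖chartFrame m p (mfderiv (𝓡 m) 𝓘(ℝ, Em m) (extChartAt (𝓡 m) p) x v)‖ ≤ r * ‖v‖) ∧
      ∀ y₁ ∈ Metric.closedBall (extChartAt (𝓡 m) p p) ρ,
        ∀ y₂ ∈ Metric.closedBall (extChartAt (𝓡 m) p p) ρ,
        dist ((extChartAt (𝓡 m) p).symm y₁) ((extChartAt (𝓡 m) p).symm y₂)
          ≤ r * ‖chartFrame m p (y₁ - y₂)‖ := by
  have hsymm : ContinuousAt (extChartAt (𝓡 m) p).symm (extChartAt (𝓡 m) p p) :=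
    continuousAt_extChartAt_symm p
  have hev := (eventually_norm_chartFrame_mfderiv_le (m := m) p hr).and
    (eventually_norm_mfderiv_extChartAt_symm_le (m := m) p hr)
  have hev' : ∀ᶠ y in 𝓝 (extChartAt (𝓡 m) p p), y ∈ (extChartAt (𝓡 m) p).target ∧
      (∀ v : TangentSpace (𝓡 m) ((extChartAt (𝓡 m) p).symm y),
        ‖chartFrame m p (mfderiv (𝓡 m) 𝓘(ℝ, Em m) (extChartAt (𝓡 m) p)
          ((extChartAt (𝓡 m) p).symm y) v)‖ ≤ r * ‖v‖) ∧
      ∀ w : Em m, ‖mfderiv 𝓘(ℝ, Em m) (𝓡 m) (extChartAt (𝓡 m) p).symm y w‖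
        ≤ r * ‖chartFrame m p w‖ := by
    have h1 : 𝓝 p = 𝓝 ((extChartAt (𝓡 m) p).symm (extChartAt (𝓡 m) p p)) := by simp
    rw [h1] at hev
    filter_upwards [hsymm.eventually hev, extChartAt_target_mem_nhds (I := 𝓡 m) p] with y hy hyt
    refine ⟨hyt, hy.1, fun w => ?_⟩
    have h2 := hy.2 w
    rw [(extChartAt (𝓡 m) p).right_inv hyt] at h2
    exact h2
  obtain ⟨ρ, hρ, hball⟩ := Metric.nhds_basis_closedBall.eventually_iff.1 hev'
  refine ⟨ρ, hρ, fun y hy => (hball hy).1, fun x hx hxb v => ?_, fun y₁ hy₁ y₂ hy₂ => ?_⟩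
  · have h3 := (hball hxb).2.1
    rw [(extChartAt (𝓡 m) p).left_inv hx] at h3
    exact h3 v
  -- the image of the coordinate segment from `y₂` to `y₁` joins the two points
  set η : ℝ → Em m := fun t => y₂ + t • (y₁ - y₂) with hη
  have hηmem : ∀ t ∈ Set.Icc (0 : ℝ) 1, η t ∈ Metric.closedBall (extChartAt (𝓡 m) p p) ρ :=
    fun t ht => (convex_closedBall _ _).add_smul_sub_mem hy₂ hy₁ ht
  have hηs : ContDiff ℝ 1 η := by fun_prop
  have hηd : ∀ t, HasDerivAt η (y₁ - y₂) t := fun t => by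
    have h := ((hasDerivAt_id t).smul_const (y₁ - y₂)).const_add y₂
    rw [one_smul] at h
    exact h
  have hγ : ContMDiffOn 𝓘(ℝ, ℝ) (𝓡 m) 1 ((extChartAt (𝓡 m) p).symm ∘ η) (Set.Icc 0 1) :=
    (contMDiffOn_extChartAt_symm (n := 1) p).comp hηs.contMDiff.contMDiffOn
      fun t ht => (hball (hηmem t ht)).1
  have hle := Manifold.riemannianEDist_le_pathELength (x := (extChartAt (𝓡 m) p).symm y₂)
    (y := (extChartAt (𝓡 m) p).symm y₁) hγ (by simp [hη]) (by simp [hη]) zero_le_one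
  rw [← IsRiemannianManifold.out, Manifold.pathELength_eq_lintegral_mfderiv_Icc] at hle
  have hspeed : ∫⁻ t in Set.Icc (0 : ℝ) 1,
      ‖mfderiv 𝓘(ℝ, ℝ) (𝓡 m) ((extChartAt (𝓡 m) p).symm ∘ η) t 1‖ₑ
      ≤ ∫⁻ t in Set.Icc (0 : ℝ) 1, ENNReal.ofReal (r * ‖chartFrame m p (y₁ - y₂)‖) := by
    refine setLIntegral_mono' measurableSet_Icc fun t ht => ?_
    have hmem := hηmem t ht
    have hsm : MDifferentiableAt 𝓘(ℝ, Em m) (𝓡 m) (extChartAt (𝓡 m) p).symm (η t) :=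
      ((contMDiffOn_extChartAt_symm (n := 1) p).contMDiffAt
        ((isOpen_extChartAt_target p).mem_nhds (hball hmem).1)).mdifferentiableAt one_ne_zero
    have hcomp : mfderiv 𝓘(ℝ, ℝ) (𝓡 m) ((extChartAt (𝓡 m) p).symm ∘ η) t 1
        = mfderiv 𝓘(ℝ, Em m) (𝓡 m) (extChartAt (𝓡 m) p).symm (η t) (y₁ - y₂) := by
      rw [mfderiv_comp t hsm (hηd t).differentiableAt.mdifferentiableAt]
      have : mfderiv 𝓘(ℝ, ℝ) 𝓘(ℝ, Em m) η t (1 : ℝ) = y₁ - y₂ := by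
        rw [mfderiv_eq_fderiv, (hηd t).hasFDerivAt.fderiv]
        exact one_smul ℝ (y₁ - y₂)
      exact congrArg _ this
    rw [hcomp, ← ofReal_norm]
    exact ENNReal.ofReal_le_ofReal ((hball hmem).2.2 _)
  have hfin := hle.trans hspeed
  rw [setLIntegral_const, Real.volume_Icc, sub_zero, ENNReal.ofReal_one, mul_one, edist_dist,
    ENNReal.ofReal_le_ofReal_iff (by positivity)] at hfin
  rwa [dist_comm]

end ChartDistance

/-! ### Mollification in the model space -/

section Mollification

variable {E : Type*} [NormedAddCommGroup E] [InnerProductSpace ℝ E] [FiniteDimensional ℝ E]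
  [MeasurableSpace E] [BorelSpace E]

theorem ContDiffBump.integral_normed_mul_le (φ : ContDiffBump (0 : E)) {h : E → ℝ} {b : ℝ}
    (hint : Integrable fun t => φ.normed volume t * h t)
    (hb : ∀ t ∈ Metric.ball (0 : E) φ.rOut, h t ≤ b) :
    ∫ t, φ.normed volume t * h t ≤ b := by
  calc ∫ t, φ.normed volume t * h t ≤ ∫ t, φ.normed volume t * b := by
        refine integral_mono hint (φ.integrable_normed.mul_const b) fun t => ?_
        by_cases ht : t ∈ Metric.ball (0 : E) φ.rOut
        · exact mul_le_mul_of_nonneg_left (hb t ht) (φ.nonneg_normed t)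
        · have : φ.normed volume t = 0 := by
            rw [← φ.support_normed_eq (μ := volume)] at ht
            exact Function.notMem_support.1 ht
          simp [this]
    _ = b := by rw [integral_mul_const, φ.integral_normed, one_mul]

/-- Mollification preserves a Lipschitz bound, even with respect to an anisotropic norm `N`, and its
values are averages of nearby values. -/
theorem exists_contDiff_fderiv_le_of_dist_le {U : E → ℝ} {N : E → ℝ} {y₀ : E} {ρ δ : ℝ}
    (hρ : 0 < ρ) (hδ : 0 < δ) (hN : ∀ (t : ℝ) w, N (t • w) = |t| * N w)
    (hN0 : ∀ w, 0 ≤ N w) (hU : ContinuousOn U (Metric.closedBall y₀ (2 * ρ)))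
    (hLip : ∀ y₁ ∈ Metric.closedBall y₀ (2 * ρ), ∀ y₂ ∈ Metric.closedBall y₀ (2 * ρ),
      U y₁ - U y₂ ≤ N (y₁ - y₂)) :
    ∃ F : E → ℝ, ContDiff ℝ ∞ F ∧ (∀ y ∈ Metric.ball y₀ ρ, ∀ w, |fderiv ℝ F y w| ≤ N w) ∧
      ∀ y ∈ Metric.ball y₀ ρ, ∀ a b,
        (∀ z ∈ Metric.ball y δ ∩ Metric.closedBall y₀ (2 * ρ), U z ∈ Set.Icc a b) →
          F y ∈ Set.Icc a b := by
  set B := Metric.closedBall y₀ (2 * ρ) with hB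
  have hσ : 0 < min δ ρ := lt_min hδ hρ
  let φ : ContDiffBump (0 : E) := ⟨min δ ρ / 2, min δ ρ, half_pos hσ, half_lt_self hσ⟩
  have hφ : φ.rOut = min δ ρ := rfl
  set V := B.indicator U with hV
  have hVint : LocallyIntegrable V := by
    refine Integrable.locallyIntegrable ?_
    rw [hV, integrable_indicator_iff Metric.isClosed_closedBall.measurableSet]
    exact hU.integrableOn_compact (isCompact_closedBall _ _)
  set F := convolution (φ.normed volume) V (ContinuousLinearMap.lsmul ℝ ℝ) volume with hF
  have hint : ∀ y, Integrable fun t => φ.normed volume t * V (y - t) := fun y =>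
    HasCompactSupport.convolutionExists_left (ContinuousLinearMap.lsmul ℝ ℝ)
      φ.hasCompactSupport_normed φ.continuous_normed hVint y
  have hFy : ∀ y, F y = ∫ t, φ.normed volume t * V (y - t) := fun y => rfl
  have hsub : ∀ y ∈ Metric.ball y₀ ρ, ∀ t ∈ Metric.ball (0 : E) φ.rOut,
      y - t ∈ Metric.ball y δ ∩ B := by
    intro y hy t ht
    rw [hφ, mem_ball_zero_iff, lt_min_iff] at ht
    refine ⟨by simpa using ht.1, ?_⟩
    have := dist_triangle (y - t) y y₀
    have h2 : dist (y - t) y = ‖t‖ := by simp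
    exact Metric.mem_closedBall.2 (by linarith [Metric.mem_ball.1 hy])
  have hVU : ∀ y ∈ Metric.ball y₀ ρ, ∀ t ∈ Metric.ball (0 : E) φ.rOut, V (y - t) = U (y - t) :=
    fun y hy t ht => Set.indicator_of_mem (hsub y hy t ht).2 _
  have hFle : ∀ y₁ ∈ Metric.ball y₀ ρ, ∀ y₂ ∈ Metric.ball y₀ ρ, F y₁ - F y₂ ≤ N (y₁ - y₂) := by
    intro y₁ h₁ y₂ h₂
    have heq : (fun t => φ.normed volume t * (V (y₁ - t) - V (y₂ - t))) = fun t =>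
        φ.normed volume t * V (y₁ - t) - φ.normed volume t * V (y₂ - t) := by
      funext t; ring
    rw [hFy, hFy, ← integral_sub (hint y₁) (hint y₂), ← heq]
    refine φ.integral_normed_mul_le (heq ▸ (hint y₁).sub (hint y₂)) fun t ht => ?_
    rw [hVU y₁ h₁ t ht, hVU y₂ h₂ t ht]
    simpa using hLip _ (hsub y₁ h₁ t ht).2 _ (hsub y₂ h₂ t ht).2
  have hFsm : ContDiff ℝ ∞ F :=
    HasCompactSupport.contDiff_convolution_left (n := ⊤) _ φ.hasCompactSupport_normed
      φ.contDiff_normed hVint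
  refine ⟨F, hFsm, fun y hy w => ?_, fun y hy a b hab => ⟨?_, ?_⟩⟩
  · have hline : HasDerivAt (fun t : ℝ => F (y + t • w)) (fderiv ℝ F y w) 0 := by
      have h1 : HasDerivAt (fun t : ℝ => y + t • w) w 0 := by
        have h := ((hasDerivAt_id (0 : ℝ)).smul_const w).const_add y
        rw [one_smul] at h
        exact h
      have h2 : HasFDerivAt F (fderiv ℝ F y) (y + (0 : ℝ) • w) := by
        simpa using (hFsm.differentiable (by simp)).differentiableAt.hasFDerivAt
      exact h2.comp_hasDerivAt (0 : ℝ) h1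
    refine hline.le_of_lip' (hN0 w) ?_
    have hev : ∀ᶠ t : ℝ in 𝓝 0, y + t • w ∈ Metric.ball y₀ ρ := by
      have hc : ContinuousAt (fun t : ℝ => y + t • w) 0 := by fun_prop
      exact hc.eventually_mem (Metric.isOpen_ball.mem_nhds (by simpa using hy))
    filter_upwards [hev] with t ht
    have e1 := hFle _ ht _ hy
    have e2 := hFle _ hy _ ht
    have e3 : y - (y + t • w) = (-t) • w := by simp
    rw [e3, hN, abs_neg] at e2
    rw [add_sub_cancel_left, hN] at e1
    rw [zero_smul, add_zero, sub_zero, Real.norm_eq_abs, Real.norm_eq_abs, abs_le]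
    constructor <;> linarith
  · have h1 := φ.integral_normed_mul_le (h := fun t => -V (y - t)) (b := -a)
      (by simpa using (hint y).neg) fun t ht => by
        rw [hVU y hy t ht]; exact neg_le_neg (hab _ (hsub y hy t ht)).1
    simp only [mul_neg, integral_neg] at h1
    rw [hFy]
    linarith
  · rw [hFy]
    exact φ.integral_normed_mul_le (hint y) fun t ht => by
      rw [hVU y hy t ht]; exact (hab _ (hsub y hy t ht)).2

end Mollification

/-! ### The norm of the differential of a smooth function -/

theorem tendsto_of_forall_one_lt_eventually_le_mul {X : Type*} {F : Filter X} {f g : X → ℝ} {c : ℝ}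
    (hg : Tendsto g F (𝓝 c))
    (h : ∀ r > (1 : ℝ), ∀ᶠ x in F, g x ≤ r * f x ∧ f x ≤ r * g x) : Tendsto f F (𝓝 c) := by
  refine tendsto_order.2 ⟨fun a ha => ?_, fun b hb => ?_⟩
  · have hlim : Tendsto (fun r : ℝ => r * a) (𝓝[>] 1) (𝓝 (1 * a)) :=
      (tendsto_id.mul_const a).mono_left nhdsWithin_le_nhds
    obtain ⟨r, hr, hr1⟩ := ((hlim.eventually_lt_const (by rwa [one_mul])).and
      (self_mem_nhdsWithin : ∀ᶠ r : ℝ in 𝓝[>] 1, 1 < r)).exists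
    filter_upwards [h r hr1, hg.eventually_const_lt hr] with x hx hx'
    exact lt_of_mul_lt_mul_left (hx'.trans_le hx.1) (by linarith)
  · have hlim : Tendsto (fun r : ℝ => r * c) (𝓝[>] 1) (𝓝 (1 * c)) :=
      (tendsto_id.mul_const c).mono_left nhdsWithin_le_nhds
    obtain ⟨r, hr, hr1⟩ := ((hlim.eventually_lt_const (by rwa [one_mul])).and
      (self_mem_nhdsWithin : ∀ᶠ r : ℝ in 𝓝[>] 1, 1 < r)).exists
    filter_upwards [h r hr1, (hg.const_mul r).eventually_lt_const hr] with x hx hx'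
    exact hx.2.trans_lt hx'

section Differential

variable {m : ℕ} {M : Type*} [TopologicalSpace M] [ChartedSpace (Em m) M]

theorem mvfderiv_congr_of_eventuallyEq {f g : M → ℝ} {x : M} (h : f =ᶠ[𝓝 x] g) :
    mvfderiv (𝓡 m) f x = mvfderiv (𝓡 m) g x := by
  ext v
  change (mfderiv (𝓡 m) 𝓘(ℝ, ℝ) f x v : ℝ) = (mfderiv (𝓡 m) 𝓘(ℝ, ℝ) g x v : ℝ)
  rw [h.mfderiv_eq]
  rfl

theorem mvfderiv_finsetSum {ι : Type*} (s : Finset ι) {f : ι → M → ℝ} {x : M}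
    (hf : ∀ i ∈ s, MDifferentiableAt (𝓡 m) 𝓘(ℝ, ℝ) (f i) x) :
    MDifferentiableAt (𝓡 m) 𝓘(ℝ, ℝ) (fun y => ∑ i ∈ s, f i y) x ∧
      mvfderiv (𝓡 m) (fun y => ∑ i ∈ s, f i y) x = ∑ i ∈ s, mvfderiv (𝓡 m) (f i) x := by
  classical
  induction s using Finset.induction_on with
  | empty => simpa using ⟨mdifferentiableAt_const, mvfderiv_const 0⟩
  | insert i s hi ih =>
    have h1 := hf i (Finset.mem_insert_self i s)
    obtain ⟨h2, h3⟩ := ih fun j hj => hf j (Finset.mem_insert_of_mem hj)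
    simp only [Finset.sum_insert hi]
    exact ⟨h1.add h2, by rw [mvfderiv_fun_add h1 h2, h3]⟩

end Differential

section NormDifferential

variable {m : ℕ} {M : Type*} [MetricSpace M] [ChartedSpace (Em m) M] [IsManifold (𝓡 m) ∞ M]
    [RiemannianBundle (fun x : M => TangentSpace (𝓡 m) x)]
    [IsContinuousRiemannianBundle (Em m) (fun x : M => TangentSpace (𝓡 m) x)]

theorem continuous_norm_mvfderiv {ψ : M → ℝ} (hψ : ContMDiff (𝓡 m) 𝓘(ℝ, ℝ) ∞ ψ) :
    Continuous fun x => ‖mvfderiv (𝓡 m) ψ x‖ := by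
  refine continuous_iff_continuousAt.2 fun p => ?_
  set φ := extChartAt (𝓡 m) p with hφ
  -- the differential at `x`, carried over to the tangent space at `p` by the chart
  set L : M → TangentSpace (𝓡 m) p →L[ℝ] ℝ := fun x => (fderiv ℝ (ψ ∘ φ.symm) (φ x)).comp
    ((trivializationAt (Em m) (TangentSpace (𝓡 m)) p).continuousLinearMapAt ℝ p) with hL
  have hp : p ∈ (trivializationAt (Em m) (TangentSpace (𝓡 m)) p).baseSet :=
    FiberBundle.mem_baseSet_trivializationAt' p
  have hsm : ∀ x ∈ φ.source, ContDiffAt ℝ ∞ (ψ ∘ φ.symm) (φ x) := fun x hx =>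
    ((hψ.comp_contMDiffOn (contMDiffOn_extChartAt_symm p)).contMDiffAt
      ((isOpen_extChartAt_target p).mem_nhds (φ.map_source hx))).contDiffAt
  have hLdiff : ∀ x y, ‖L x‖ ≤ ‖L y‖
      + ‖fderiv ℝ (ψ ∘ φ.symm) (φ x) - fderiv ℝ (ψ ∘ φ.symm) (φ y)‖
        * ‖(trivializationAt (Em m) (TangentSpace (𝓡 m)) p).continuousLinearMapAt ℝ p‖ := by
    intro x y
    have hK := ContinuousLinearMap.opNorm_nonneg
      ((trivializationAt (Em m) (TangentSpace (𝓡 m)) p).continuousLinearMapAt ℝ p)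
    have hy := ContinuousLinearMap.opNorm_nonneg (L y)
    refine ContinuousLinearMap.opNorm_le_bound _ (by positivity) fun v => ?_
    set w := (trivializationAt (Em m) (TangentSpace (𝓡 m)) p).continuousLinearMapAt ℝ p v with hw
    have h1 : L x v = L y v
        + (fderiv ℝ (ψ ∘ φ.symm) (φ x) - fderiv ℝ (ψ ∘ φ.symm) (φ y)) w := by
      simp [hL, hw]
    rw [h1, add_mul, mul_assoc]
    refine (norm_add_le _ _).trans (add_le_add (ContinuousLinearMap.le_opNorm _ _) ?_)
    refine (ContinuousLinearMap.le_opNorm _ _).trans ?_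
    gcongr
    exact ContinuousLinearMap.le_opNorm _ _
  have hLc : Tendsto (fun x => ‖L x‖) (𝓝 p) (𝓝 ‖L p‖) := by
    have h1 : ContinuousAt (fderiv ℝ (ψ ∘ φ.symm)) (φ p) :=
      ((hsm p (mem_extChartAt_source p)).fderiv_right (m := 0) (by simp)).continuousAt
    have h2 : ContinuousAt (fun x => fderiv ℝ (ψ ∘ φ.symm) (φ x)) p :=
      ContinuousAt.comp (f := φ) h1 (continuousAt_extChartAt p)
    have h3 := (tendsto_iff_norm_sub_tendsto_zero.1 h2).mul_const
      ‖(trivializationAt (Em m) (TangentSpace (𝓡 m)) p).continuousLinearMapAt ℝ p‖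
    rw [zero_mul] at h3
    refine tendsto_iff_dist_tendsto_zero.2
      (squeeze_zero (fun _ => dist_nonneg) (fun x => ?_) h3)
    have h4 := hLdiff p x
    rw [norm_sub_rev] at h4
    rw [Real.dist_eq, abs_le]
    constructor <;> linarith [hLdiff x p]
  have hto : ∀ x ∈ φ.source, ∀ w : Em m, fderiv ℝ (ψ ∘ φ.symm) (φ x) w
      = mvfderiv (𝓡 m) ψ (φ.symm (φ x))
        (mfderiv 𝓘(ℝ, Em m) (𝓡 m) φ.symm (φ x) w) := by
    intro x hx w
    have hs : MDifferentiableAt 𝓘(ℝ, Em m) (𝓡 m) φ.symm (φ x) :=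
      ((contMDiffOn_extChartAt_symm (n := ∞) p).contMDiffAt
        ((isOpen_extChartAt_target p).mem_nhds (φ.map_source hx))).mdifferentiableAt (by simp)
    have hd := hψ.mdifferentiableAt (x := φ.symm (φ x)) (by simp)
    exact congrArg (fun T : Em m →L[ℝ] ℝ => T w)
      (mfderiv_eq_fderiv.symm.trans (mfderiv_comp (φ x) hd hs))
  have hfrom : ∀ x ∈ φ.source, ∀ v : TangentSpace (𝓡 m) x, mvfderiv (𝓡 m) ψ x v
      = fderiv ℝ (ψ ∘ φ.symm) (φ x) (mfderiv (𝓡 m) 𝓘(ℝ, Em m) φ x v) := by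
    intro x hx v
    have hd : MDifferentiableAt 𝓘(ℝ, Em m) 𝓘(ℝ, ℝ) (ψ ∘ φ.symm) (φ x) :=
      ((hsm x hx).differentiableAt (by simp)).mdifferentiableAt
    have hc : MDifferentiableAt (𝓡 m) 𝓘(ℝ, Em m) φ x :=
      mdifferentiableAt_extChartAt (by simpa [hφ] using hx)
    have heq : ψ =ᶠ[𝓝 x] (ψ ∘ φ.symm) ∘ φ := by
      filter_upwards [(isOpen_extChartAt_source p).mem_nhds hx] with z hz
      simp [φ.left_inv hz]
    rw [mvfderiv_congr_of_eventuallyEq heq, mvfderiv_comp_apply x hd hc]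
    exact congrArg (fun T : Em m →L[ℝ] ℝ => T (mfderiv (𝓡 m) 𝓘(ℝ, Em m) φ x v)) mfderiv_eq_fderiv
  have hlim : Tendsto (fun x => ‖mvfderiv (𝓡 m) ψ x‖) (𝓝 p) (𝓝 ‖L p‖) := by
    refine tendsto_of_forall_one_lt_eventually_le_mul hLc fun r hr => ?_
    filter_upwards [eventually_norm_chartFrame_mfderiv_le (m := m) p hr,
      eventually_norm_mfderiv_extChartAt_symm_le (m := m) p hr,
      (isOpen_extChartAt_source p).mem_nhds (mem_extChartAt_source (I := 𝓡 m) p)] with x h1 h2 hx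
    constructor
    · refine ContinuousLinearMap.opNorm_le_bound _ (by positivity) fun v => ?_
      set w := (trivializationAt (Em m) (TangentSpace (𝓡 m)) p).continuousLinearMapAt ℝ p v with hw
      have h3 : ‖mfderiv 𝓘(ℝ, Em m) (𝓡 m) φ.symm (φ x) w‖ ≤ r * ‖v‖ := by
        have := h2 w
        rwa [hw, chartFrame, Trivialization.symmL_continuousLinearMapAt _ hp] at this
      have h4 : L x v = _ := hto x hx w
      have h5 : ‖mvfderiv (𝓡 m) ψ (φ.symm (φ x))‖ = ‖mvfderiv (𝓡 m) ψ x‖ := by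
        rw [φ.left_inv hx]
      rw [h4]
      calc _ ≤ ‖mvfderiv (𝓡 m) ψ (φ.symm (φ x))‖
            * ‖mfderiv 𝓘(ℝ, Em m) (𝓡 m) φ.symm (φ x) w‖ := ContinuousLinearMap.le_opNorm _ _
        _ ≤ ‖mvfderiv (𝓡 m) ψ (φ.symm (φ x))‖ * (r * ‖v‖) :=
            mul_le_mul_of_nonneg_left h3 (ContinuousLinearMap.opNorm_nonneg _)
        _ = _ := by rw [h5]; ring
    · refine ContinuousLinearMap.opNorm_le_bound _ (by positivity) fun v => ?_
      have h3 : mvfderiv (𝓡 m) ψ x v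
          = L x (chartFrame m p (mfderiv (𝓡 m) 𝓘(ℝ, Em m) φ x v)) := by
        rw [hfrom x hx v]
        exact congrArg (fderiv ℝ (ψ ∘ φ.symm) (φ x))
          (Trivialization.continuousLinearMapAt_symmL _ hp _).symm
      rw [h3]
      calc _ ≤ ‖L x‖ * ‖chartFrame m p (mfderiv (𝓡 m) 𝓘(ℝ, Em m) φ x v)‖ :=
            ContinuousLinearMap.le_opNorm _ _
        _ ≤ ‖L x‖ * (r * ‖v‖) := by gcongr; exact h1 v
        _ = _ := by ring
  have hval : ‖mvfderiv (𝓡 m) ψ p‖ = ‖L p‖ := tendsto_nhds_unique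
    (tendsto_pure_nhds _ p) (hlim.mono_left (pure_le_nhds p))
  rw [ContinuousAt, hval]
  exact hlim

end NormDifferential

/-! ### Smooth approximation of Lipschitz functions -/

section LocalSmoothing

variable {m : ℕ} {M : Type*} [MetricSpace M] [ChartedSpace (Em m) M] [IsManifold (𝓡 m) ∞ M]
    [RiemannianBundle (fun x : M => TangentSpace (𝓡 m) x)]
    [IsContinuousRiemannianBundle (Em m) (fun x : M => TangentSpace (𝓡 m) x)]

/-- Around every point, functions with Lipschitz constant `1` are approximated by smooth functions
whose differential has norm at most `r ^ 2`; the values of the approximation are averages of nearby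
values. -/
theorem exists_isOpen_forall_exists_contMDiffOn [IsRiemannianManifold (𝓡 m) M] (p : M) {r : ℝ}
    (hr : 1 < r) :
    ∃ W : Set M, IsOpen W ∧ p ∈ W ∧ ∀ u : M → ℝ, (∀ x y, u x - u y ≤ dist x y) → ∀ ε > 0,
      ∃ f : M → ℝ, ContMDiffOn (𝓡 m) 𝓘(ℝ, ℝ) ∞ f W ∧ (∀ x ∈ W, ‖mvfderiv (𝓡 m) f x‖ ≤ r ^ 2) ∧
        ∀ x ∈ W, ∀ a b, (∀ z ∈ Metric.ball x ε, u z ∈ Set.Icc a b) → f x ∈ Set.Icc a b := by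
  obtain ⟨ρ, hρ, htar, hdiff, hdist⟩ := exists_chart_ball_comparison (m := m) p hr
  set φ := extChartAt (𝓡 m) p with hφ
  have hWo : IsOpen (φ.source ∩ φ ⁻¹' Metric.ball (φ p) (ρ / 2)) :=
    (continuousOn_extChartAt p).isOpen_inter_preimage (isOpen_extChartAt_source p)
      Metric.isOpen_ball
  refine ⟨_, hWo, ⟨mem_extChartAt_source p, by simpa using hρ⟩, fun u hu ε hε => ?_⟩
  have hρ2 : 2 * (ρ / 2) = ρ := by ring
  have hr0 : 0 < r := by linarith
  have hLip : ∀ y₁ ∈ Metric.closedBall (φ p) (2 * (ρ / 2)),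
      ∀ y₂ ∈ Metric.closedBall (φ p) (2 * (ρ / 2)),
      (u ∘ φ.symm) y₁ - (u ∘ φ.symm) y₂ ≤ r * ‖chartFrame m p (y₁ - y₂)‖ := by
    rw [hρ2]
    exact fun y₁ h₁ y₂ h₂ => (hu _ _).trans (hdist y₁ h₁ y₂ h₂)
  have huc : Continuous u := by
    refine (LipschitzWith.of_dist_le_mul (K := 1) fun x y => ?_).continuous
    rw [Real.dist_eq, NNReal.coe_one, one_mul, abs_le]
    constructor <;> linarith [hu x y, hu y x, dist_comm x y]
  have hUc : ContinuousOn (u ∘ φ.symm) (Metric.closedBall (φ p) (2 * (ρ / 2))) := by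
    rw [hρ2]
    exact huc.comp_continuousOn ((continuousOn_extChartAt_symm p).mono htar)
  set C := ‖chartFrame m p‖ with hC
  have hC0 : 0 ≤ C := ContinuousLinearMap.opNorm_nonneg _
  obtain ⟨F, hF, hFd, hFv⟩ := exists_contDiff_fderiv_le_of_dist_le (U := u ∘ φ.symm)
    (N := fun w => r * ‖chartFrame m p w‖) (half_pos hρ) (δ := ε / (r * (C + 1))) (by positivity)
    (fun t w => by rw [map_smul, norm_smul, Real.norm_eq_abs]; ring) (fun w => by positivity)
    hUc hLip
  refine ⟨F ∘ φ, ?_, fun x hx => ?_, fun x hx a b hab => ?_⟩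
  · exact hF.contMDiff.comp_contMDiffOn
      ((contMDiffOn_extChartAt (x := p)).mono fun x hx => by simpa [hφ] using hx.1)
  · refine ContinuousLinearMap.opNorm_le_bound _ (by positivity) fun v => ?_
    have hd : MDifferentiableAt 𝓘(ℝ, Em m) 𝓘(ℝ, ℝ) F (φ x) :=
      (hF.differentiable (by simp)).differentiableAt.mdifferentiableAt
    have hc : MDifferentiableAt (𝓡 m) 𝓘(ℝ, Em m) φ x :=
      mdifferentiableAt_extChartAt (by simpa [hφ] using hx.1)
    have h1 : mvfderiv (𝓡 m) (F ∘ φ) x v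
        = fderiv ℝ F (φ x) (mfderiv (𝓡 m) 𝓘(ℝ, Em m) φ x v) := by
      rw [mvfderiv_comp_apply x hd hc]
      exact congrArg (fun T : Em m →L[ℝ] ℝ => T (mfderiv (𝓡 m) 𝓘(ℝ, Em m) φ x v))
        mfderiv_eq_fderiv
    rw [h1, Real.norm_eq_abs]
    calc _ ≤ r * ‖chartFrame m p (mfderiv (𝓡 m) 𝓘(ℝ, Em m) φ x v)‖ := hFd _ hx.2 _
      _ ≤ r * (r * ‖v‖) := by
        gcongr
        exact hdiff x hx.1 (Metric.mem_closedBall.2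
          (by linarith [Metric.mem_ball.1 (Set.mem_preimage.1 hx.2)])) v
      _ = r ^ 2 * ‖v‖ := by ring
  · refine hFv _ hx.2 a b fun z hz => hab _ ?_
    rw [hρ2] at hz
    have hxρ : φ x ∈ Metric.closedBall (φ p) ρ := Metric.mem_closedBall.2
      (by linarith [Metric.mem_ball.1 (Set.mem_preimage.1 hx.2)])
    have h1 := hdist z hz.2 (φ x) hxρ
    rw [φ.left_inv hx.1] at h1
    have h2 : ‖chartFrame m p (z - φ x)‖ ≤ C * dist z (φ x) := by
      rw [dist_eq_norm]; exact ContinuousLinearMap.le_opNorm _ _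
    have h3 : dist z (φ x) * (r * (C + 1)) < ε :=
      (lt_div_iff₀ (by positivity)).1 (Metric.mem_ball.1 hz.1)
    refine Metric.mem_ball.2 (lt_of_le_of_lt (h1.trans ?_) h3)
    calc r * ‖chartFrame m p (z - φ x)‖ ≤ r * (C * dist z (φ x)) := by gcongr
      _ ≤ r * ((C + 1) * dist z (φ x)) := by gcongr; linarith
      _ = _ := by ring

end LocalSmoothing

section Gluing

variable {m : ℕ} {M : Type*} [MetricSpace M] [ChartedSpace (Em m) M] [IsManifold (𝓡 m) ∞ M]
    [RiemannianBundle (fun x : M => TangentSpace (𝓡 m) x)]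
    [IsContinuousRiemannianBundle (Em m) (fun x : M => TangentSpace (𝓡 m) x)]

/-- A nonnegative function with Lipschitz constant `1` and support in a closed ball is uniformly
approximated by smooth functions supported in a slightly larger ball, with differentials of norm
at most `A` for any given `A > 1`. The local approximations `f i` are glued by a partition of unity
`ρ`; since `∑ dρ i = 0`, the differential of the sum is `∑ (ρ i * df i + (f i - u) * dρ i)`, and the
second term is small. -/
theorem exists_contMDiff_approx_of_lipschitz [IsRiemannianManifold (𝓡 m) M] [ProperSpace M]
    {u : M → ℝ} (hu : ∀ x y, u x - u y ≤ dist x y) (hu0 : ∀ x, 0 ≤ u x) {x₀ : M} {s t : ℝ}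
    (hst : s < t) (hus : ∀ x, s < dist x x₀ → u x = 0) {A ε : ℝ} (hA : 1 < A) (hε : 0 < ε) :
    ∃ f : M → ℝ, ContMDiff (𝓡 m) 𝓘(ℝ, ℝ) ∞ f ∧ (∀ x, 0 ≤ f x) ∧
      tsupport f ⊆ Metric.closedBall x₀ t ∧ (∀ x, |f x - u x| ≤ ε) ∧
      ∀ x, ‖mvfderiv (𝓡 m) f x‖ ≤ A := by
  classical
  obtain ⟨r, hr1, hrA⟩ : ∃ r : ℝ, 1 < r ∧ r ^ 2 < A := by
    refine ⟨√((1 + A) / 2), Real.lt_sqrt_of_sq_lt (by linarith), ?_⟩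
    rw [Real.sq_sqrt (by linarith)]
    linarith
  choose W hWo hpW hW using fun p : M => exists_isOpen_forall_exists_contMDiffOn (m := m) p hr1
  have hK : IsCompact (Metric.closedBall x₀ t) := isCompact_closedBall x₀ t
  obtain ⟨T, -, hT⟩ := hK.elim_nhds_subcover W fun p _ => (hWo p).mem_nhds (hpW p)
  obtain ⟨ρ, hρ⟩ := SmoothPartitionOfUnity.exists_isSubordinate (𝓡 m)
    (Metric.isClosed_closedBall (x := x₀) (ε := t)) (fun i : T => W i) (fun i => hWo i)
    (hT.trans (by rw [Set.iUnion_subtype]))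
  have hbound : ∀ i : T, ∃ C : ℝ, 0 ≤ C ∧
      ∀ x ∈ Metric.closedBall x₀ t, ‖mvfderiv (𝓡 m) (ρ i) x‖ ≤ C := fun i => by
    obtain ⟨C, hC⟩ := hK.bddAbove_image
      (continuous_norm_mvfderiv (m := m) (ρ i).contMDiff).continuousOn
    exact ⟨max C 0, le_max_right _ _, fun x hx => (hC ⟨x, hx, rfl⟩).trans (le_max_left _ _)⟩
  choose C hC0 hC using hbound
  have hCs : 0 ≤ ∑ i, C i := Finset.sum_nonneg fun i _ => hC0 i
  obtain ⟨η, hη, hηε, hηA, hηt⟩ : ∃ η > 0, η ≤ ε ∧ η * ∑ i, C i ≤ A - r ^ 2 ∧ s + η < t := by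
    refine ⟨min ε (min ((A - r ^ 2) / (∑ i, C i + 1)) ((t - s) / 2)), ?_, min_le_left _ _, ?_, ?_⟩
    · have : 0 < (A - r ^ 2) / (∑ i, C i + 1) := div_pos (by linarith) (by linarith)
      exact lt_min hε (lt_min this (by linarith))
    · calc _ ≤ (A - r ^ 2) / (∑ i, C i + 1) * (∑ i, C i + 1) := by
            exact mul_le_mul ((min_le_right _ _).trans (min_le_left _ _)) (by linarith) hCs
              (div_nonneg (by linarith) (by linarith))
        _ = A - r ^ 2 := div_mul_cancel₀ _ (by linarith)
    · have := (min_le_right ε (min ((A - r ^ 2) / (∑ i, C i + 1)) ((t - s) / 2))).trans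
        (min_le_right _ _)
      linarith
  choose g hgs hgd hgv using fun i : T => hW i u hu η hη
  have hgu : ∀ i : T, ∀ x ∈ W i, |g i x - u x| ≤ η := fun i x hx => by
    have h := hgv i x hx (u x - η) (u x + η) fun z hz => by
      have h1 := Metric.mem_ball.1 hz
      constructor <;> linarith [hu x z, hu z x, dist_comm x z]
    rw [abs_le]
    constructor <;> linarith [h.1, h.2]
  have hg0 : ∀ i : T, ∀ x ∈ W i, 0 ≤ g i x := fun i x hx =>
    (hgv i x hx 0 (u x + η) fun z hz => ⟨hu0 z, by
      linarith [hu z x, Metric.mem_ball.1 hz]⟩).1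
  have hgz : ∀ i : T, ∀ x ∈ W i, s + η < dist x x₀ → g i x = 0 := fun i x hx hxs => by
    have h := hgv i x hx 0 0 fun z hz => by
      rw [hus z (by linarith [dist_triangle x z x₀, dist_comm x z, Metric.mem_ball.1 hz])]
      simp
    exact le_antisymm h.2 h.1
  have hρW : ∀ (i : T) x, x ∉ W i → ρ i x = 0 := fun i x hx =>
    image_eq_zero_of_notMem_tsupport fun h => hx (hρ i h)
  have hsum : ∀ x ∈ Metric.closedBall x₀ t, ∑ i, ρ i x = 1 := fun x hx => by
    rw [← finsum_eq_sum_of_fintype]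
    exact ρ.sum_eq_one hx
  have hterm : ∀ i, ContMDiff (𝓡 m) 𝓘(ℝ, ℝ) ∞ fun x => ρ i x * g i x := fun i =>
    ρ.contMDiff_smul (n := ⊤) fun x hx => (hgs i).contMDiffAt ((hWo i).mem_nhds (hρ i hx))
  set f : M → ℝ := fun x => ∑ i, ρ i x * g i x with hf
  have hfz : ∀ x, s + η < dist x x₀ → f x = 0 := fun x hx =>
    Finset.sum_eq_zero fun i _ => by
      by_cases hxW : x ∈ W i
      · rw [hgz i x hxW hx, mul_zero]
      · rw [hρW i x hxW, zero_mul]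
  have hsupp : tsupport f ⊆ Metric.closedBall x₀ (s + η) :=
    closure_minimal (fun x hx => by
      by_contra hcon
      exact hx (hfz x (not_le.1 hcon))) Metric.isClosed_closedBall
  refine ⟨f, contMDiff_finsetSum fun i _ => hterm i, fun x => ?_,
    hsupp.trans (Metric.closedBall_subset_closedBall hηt.le), fun x => ?_, fun x => ?_⟩
  · refine Finset.sum_nonneg fun i _ => ?_
    by_cases hxW : x ∈ W i
    · exact mul_nonneg (ρ.nonneg i x) (hg0 i x hxW)
    · rw [hρW i x hxW, zero_mul]
  · rcases le_or_gt (dist x x₀) (s + η) with hx | hx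
    · have hxt : x ∈ Metric.closedBall x₀ t := hx.trans hηt.le
      have h1 : f x - u x = ∑ i, ρ i x * (g i x - u x) := by
        simp only [hf, mul_sub, Finset.sum_sub_distrib, ← Finset.sum_mul, hsum x hxt, one_mul]
      rw [h1]
      calc _ ≤ ∑ i, |ρ i x * (g i x - u x)| := Finset.abs_sum_le_sum_abs _ _
        _ ≤ ∑ i, ρ i x * ε := by
          refine Finset.sum_le_sum fun i _ => ?_
          rw [abs_mul, abs_of_nonneg (ρ.nonneg i x)]
          by_cases hxW : x ∈ W i
          · exact mul_le_mul_of_nonneg_left ((hgu i x hxW).trans hηε) (ρ.nonneg i x)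
          · simp [hρW i x hxW]
        _ = ε := by rw [← Finset.sum_mul, hsum x hxt, one_mul]
    · rw [hfz x hx, hus x (by linarith), sub_zero, abs_zero]
      exact hε.le
  · rcases le_or_gt (dist x x₀) (s + η) with hx | hx
    · have hxt : x ∈ Metric.closedBall x₀ t := hx.trans hηt.le
      have hdρ : ∑ i, mvfderiv (𝓡 m) (ρ i) x = 0 := by
        rw [← (mvfderiv_finsetSum Finset.univ fun i _ =>
          (ρ i).contMDiff.mdifferentiableAt (by simp)).2]
        have : (fun y => ∑ i, ρ i y) =ᶠ[𝓝 x] fun _ => (1 : ℝ) := by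
          filter_upwards [Metric.isOpen_ball.mem_nhds
            (show x ∈ Metric.ball x₀ t from hx.trans_lt hηt)] with y hy
          exact hsum y (Metric.ball_subset_closedBall hy)
        rw [mvfderiv_congr_of_eventuallyEq this, mvfderiv_const]
      have hdf : mvfderiv (𝓡 m) f x = ∑ i, mvfderiv (𝓡 m) (fun y => ρ i y * g i y) x :=
        (mvfderiv_finsetSum Finset.univ fun i _ => (hterm i).mdifferentiableAt (by simp)).2
      refine ContinuousLinearMap.opNorm_le_bound _ (by linarith) fun v => ?_
      have h1 : mvfderiv (𝓡 m) f x v = ∑ i, (mvfderiv (𝓡 m) (fun y => ρ i y * g i y) x v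
          - u x * mvfderiv (𝓡 m) (ρ i) x v) := by
        rw [Finset.sum_sub_distrib, ← Finset.mul_sum, hdf]
        have h2 : ∑ i, mvfderiv (𝓡 m) (ρ i) x v = 0 := by
          rw [← sum_apply, hdρ]; rfl
        rw [h2, sum_apply]
        ring
      rw [h1]
      have h3 : ∀ i, ‖mvfderiv (𝓡 m) (fun y => ρ i y * g i y) x v
          - u x * mvfderiv (𝓡 m) (ρ i) x v‖ ≤ ρ i x * (r ^ 2 * ‖v‖) + η * (C i * ‖v‖) := by
        intro i
        have hdi := ContinuousLinearMap.le_of_opNorm_le _ (hC i x hxt) v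
        by_cases hxs : x ∈ tsupport (ρ i)
        · have hxW := hρ i hxs
          have hdg := ContinuousLinearMap.le_of_opNorm_le _ (hgd i x hxW) v
          have e1 : mvfderiv (𝓡 m) (fun y => ρ i y * g i y) x v = ρ i x * mvfderiv (𝓡 m) (g i) x v
              + g i x * mvfderiv (𝓡 m) (ρ i) x v := by
            rw [mvfderiv_fun_mul ((ρ i).contMDiff.mdifferentiableAt (by simp))
              (((hgs i).contMDiffAt ((hWo i).mem_nhds hxW)).mdifferentiableAt (by simp))]
            rfl
          have e2 : mvfderiv (𝓡 m) (fun y => ρ i y * g i y) x v - u x * mvfderiv (𝓡 m) (ρ i) x v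
              = ρ i x * mvfderiv (𝓡 m) (g i) x v
                + (g i x - u x) * mvfderiv (𝓡 m) (ρ i) x v := by
            rw [e1]; ring
          rw [e2]
          refine (norm_add_le _ _).trans ?_
          rw [norm_mul, norm_mul, Real.norm_of_nonneg (ρ.nonneg i x), Real.norm_eq_abs (g i x - u x)]
          exact add_le_add (mul_le_mul_of_nonneg_left hdg (ρ.nonneg i x))
            (mul_le_mul (hgu i x hxW) hdi (norm_nonneg _) hη.le)
        · have hz : (ρ i : M → ℝ) =ᶠ[𝓝 x] fun _ => 0 :=
            notMem_tsupport_iff_eventuallyEq.1 hxs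
          have hz' : (fun y => ρ i y * g i y) =ᶠ[𝓝 x] fun _ => 0 := by
            filter_upwards [hz] with y hy
            rw [hy, zero_mul]
          rw [mvfderiv_congr_of_eventuallyEq hz', mvfderiv_congr_of_eventuallyEq hz,
            mvfderiv_const]
          have : 0 ≤ ρ i x * (r ^ 2 * ‖v‖) + η * (C i * ‖v‖) :=
            add_nonneg (mul_nonneg (ρ.nonneg i x) (by positivity))
              (mul_nonneg hη.le (mul_nonneg (hC0 i) (norm_nonneg _)))
          simpa using this
      calc _ ≤ ∑ i, (ρ i x * (r ^ 2 * ‖v‖) + η * (C i * ‖v‖)) :=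
            (norm_sum_le _ _).trans (Finset.sum_le_sum fun i _ => h3 i)
        _ = (r ^ 2 + η * ∑ i, C i) * ‖v‖ := by
            rw [Finset.sum_add_distrib, ← Finset.sum_mul, hsum x hxt, ← Finset.mul_sum,
              ← Finset.sum_mul]
            ring
        _ ≤ A * ‖v‖ := by gcongr; linarith
    · have hz : f =ᶠ[𝓝 x] fun _ => 0 := by
        filter_upwards [(isOpen_lt continuous_const (continuous_id.dist continuous_const)).mem_nhds
          hx] with y hy
        exact hfz y hy
      rw [mvfderiv_congr_of_eventuallyEq hz, mvfderiv_const]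
      exact (ContinuousLinearMap.opNorm_zero).trans_le (by linarith)

end Gluing

/-! ### The volume of small balls -/

section Volume

variable {m : ℕ} {M : Type*} [MetricSpace M] [ChartedSpace (Em m) M]

theorem chartFrame_injective [IsManifold (𝓡 m) ∞ M] (p : M) : Function.Injective (chartFrame m p) := by
  intro v w h
  have hp : p ∈ (trivializationAt (Em m) (TangentSpace (𝓡 m)) p).baseSet :=
    FiberBundle.mem_baseSet_trivializationAt' p
  rw [← Trivialization.continuousLinearMapAt_symmL (R := ℝ) _ hp v,
    ← Trivialization.continuousLinearMapAt_symmL (R := ℝ) _ hp w]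
  exact congrArg _ h

variable [RiemannianBundle (fun x : M => TangentSpace (𝓡 m) x)]

/-- The Riemannian volume dominates the volume of the chart at `p`. -/
theorem lintegral_metricMatrix_det_le_riemannianVolume [MeasurableSpace M] [BorelSpace M]
    (p : M) (S : Set M) :
    ∫⁻ y in (extChartAt (𝓡 m) p).symm ⁻¹' S ∩ (extChartAt (𝓡 m) p).target,
      ENNReal.ofReal (Real.sqrt (metricMatrix m p y).det) ≤ riemannianVolume m M S := by
  have hmeas : AEMeasurable (extChartAt (𝓡 m) p).symm
      ((volume.restrict (extChartAt (𝓡 m) p).target).withDensity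
        fun y => ENNReal.ofReal (Real.sqrt (metricMatrix m p y).det)) :=
    ((continuousOn_extChartAt_symm p).aemeasurable
      (isOpen_extChartAt_target p).measurableSet).mono_ac (withDensity_absolutelyContinuous _ _)
  calc _ = ∫⁻ y in (extChartAt (𝓡 m) p).symm ⁻¹' S,
        ENNReal.ofReal (Real.sqrt (metricMatrix m p y).det)
          ∂(volume.restrict (extChartAt (𝓡 m) p).target) := by
        rw [Measure.restrict_restrict₀' (isOpen_extChartAt_target p).measurableSet.nullMeasurableSet]
    _ ≤ _ := withDensity_apply_le _ _
    _ ≤ chartVolume m p S := Measure.le_map_apply hmeas S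
    _ ≤ riemannianVolume m M S := le_iSup (fun q : M => chartVolume m q) p S

variable [IsManifold (𝓡 m) ∞ M]
    [IsContinuousRiemannianBundle (Em m) (fun x : M => TangentSpace (𝓡 m) x)]

theorem tendsto_norm_mfderiv_extChartAt_symm (p : M) (w : Em m) :
    Tendsto (fun y => ‖mfderiv 𝓘(ℝ, Em m) (𝓡 m) (extChartAt (𝓡 m) p).symm y w‖)
      (𝓝 (extChartAt (𝓡 m) p p)) (𝓝 ‖chartFrame m p w‖) := by
  refine tendsto_of_forall_one_lt_eventually_le_mul tendsto_const_nhds fun r hr => ?_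
  have hev := (eventually_norm_chartFrame_mfderiv_le (m := m) p hr).and
    (eventually_norm_mfderiv_extChartAt_symm_le (m := m) p hr)
  rw [show 𝓝 p = 𝓝 ((extChartAt (𝓡 m) p).symm (extChartAt (𝓡 m) p p)) by simp] at hev
  filter_upwards [(continuousAt_extChartAt_symm (I := 𝓡 m) p).eventually hev,
    extChartAt_target_mem_nhds (I := 𝓡 m) p] with y hy hyt
  constructor
  · have h1 := hy.1 (mfderiv 𝓘(ℝ, Em m) (𝓡 m) (extChartAt (𝓡 m) p).symm y w)
    have hs : MDifferentiableAt 𝓘(ℝ, Em m) (𝓡 m) (extChartAt (𝓡 m) p).symm y :=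
      ((contMDiffOn_extChartAt_symm (n := 1) p).contMDiffAt
        ((isOpen_extChartAt_target p).mem_nhds hyt)).mdifferentiableAt one_ne_zero
    have hc : MDifferentiableAt (𝓡 m) 𝓘(ℝ, Em m) (extChartAt (𝓡 m) p)
        ((extChartAt (𝓡 m) p).symm y) :=
      mdifferentiableAt_extChartAt (by simpa using (extChartAt (𝓡 m) p).map_target hyt)
    have h2 : mfderiv (𝓡 m) 𝓘(ℝ, Em m) (extChartAt (𝓡 m) p) ((extChartAt (𝓡 m) p).symm y)
        (mfderiv 𝓘(ℝ, Em m) (𝓡 m) (extChartAt (𝓡 m) p).symm y w) = w := by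
      have h3 : (extChartAt (𝓡 m) p) ∘ (extChartAt (𝓡 m) p).symm =ᶠ[𝓝 y] id := by
        filter_upwards [(isOpen_extChartAt_target p).mem_nhds hyt] with z hz
        exact (extChartAt (𝓡 m) p).right_inv hz
      have h4 := (mfderiv_comp y hc hs).symm.trans (h3.mfderiv_eq.trans mfderiv_id)
      exact congrArg (fun T : Em m →L[ℝ] Em m => T w) h4
    exact (congrArg (fun z : Em m => ‖chartFrame m p z‖) h2).symm.trans_le h1
  · have h1 := hy.2 w
    rwa [(extChartAt (𝓡 m) p).right_inv hyt] at h1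

/-- The entries of the metric are expressed by norms through polarization, so the convergence of the
norms suffices. -/
theorem tendsto_metricMatrix_det (p : M) :
    Tendsto (fun y => (metricMatrix m p y).det) (𝓝 (extChartAt (𝓡 m) p p))
      (𝓝 (Matrix.gram ℝ fun i => chartFrame m p (EuclideanSpace.single i (1 : ℝ))).det) := by
  have hc : Continuous fun B : Matrix (Fin m) (Fin m) ℝ => B.det := continuous_id.matrix_det
  have h := tendsto_norm_mfderiv_extChartAt_symm (m := m) p
  refine (hc.tendsto _).comp (tendsto_pi_nhds.2 fun i => tendsto_pi_nhds.2 fun j => ?_)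
  set v : Em m := EuclideanSpace.single i (1 : ℝ) with hv
  set w : Em m := EuclideanSpace.single j (1 : ℝ) with hw
  have hlhs : (fun y => metricMatrix m p y i j) = fun y =>
      (‖mfderiv 𝓘(ℝ, Em m) (𝓡 m) (extChartAt (𝓡 m) p).symm y (v + w)‖
          * ‖mfderiv 𝓘(ℝ, Em m) (𝓡 m) (extChartAt (𝓡 m) p).symm y (v + w)‖
        - ‖mfderiv 𝓘(ℝ, Em m) (𝓡 m) (extChartAt (𝓡 m) p).symm y v‖
          * ‖mfderiv 𝓘(ℝ, Em m) (𝓡 m) (extChartAt (𝓡 m) p).symm y v‖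
        - ‖mfderiv 𝓘(ℝ, Em m) (𝓡 m) (extChartAt (𝓡 m) p).symm y w‖
          * ‖mfderiv 𝓘(ℝ, Em m) (𝓡 m) (extChartAt (𝓡 m) p).symm y w‖) / 2 := by
    funext y
    have hadd : mfderiv 𝓘(ℝ, Em m) (𝓡 m) (extChartAt (𝓡 m) p).symm y (v + w)
        = coordField m p y i + coordField m p y j := map_add _ _ _
    rw [hadd]
    exact real_inner_eq_norm_add_mul_self_sub_norm_mul_self_sub_norm_mul_self_div_two
      (coordField m p y i) (coordField m p y j)
  have hrhs : Matrix.gram ℝ (fun i => chartFrame m p (EuclideanSpace.single i (1 : ℝ))) i j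
      = (‖chartFrame m p (v + w)‖ * ‖chartFrame m p (v + w)‖
        - ‖chartFrame m p v‖ * ‖chartFrame m p v‖
        - ‖chartFrame m p w‖ * ‖chartFrame m p w‖) / 2 := by
    rw [map_add]
    exact real_inner_eq_norm_add_mul_self_sub_norm_mul_self_sub_norm_mul_self_div_two
      (chartFrame m p v) (chartFrame m p w)
  rw [hlhs, hrhs]
  exact ((((h _).mul (h _)).sub ((h _).mul (h _))).sub ((h _).mul (h _))).div_const 2

theorem exists_eventually_le_riemannianVolume_ball [IsRiemannianManifold (𝓡 m) M]
    [MeasurableSpace M] [BorelSpace M] (p : M) :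
    ∃ c > 0, ∀ᶠ r in 𝓝[>] (0 : ℝ),
      ENNReal.ofReal (c * r ^ m) ≤ riemannianVolume m M (Metric.ball p r) := by
  obtain ⟨ρ, hρ, htar, -, hdist⟩ := exists_chart_ball_comparison (m := m) p one_lt_two
  set φ := extChartAt (𝓡 m) p with hφ
  set D := (Matrix.gram ℝ fun i => chartFrame m p (EuclideanSpace.single i (1 : ℝ))).det with hD
  have hD0 : 0 < D := by
    refine (Matrix.posDef_gram_of_linearIndependent ?_).det_pos
    have h := (EuclideanSpace.basisFun (Fin m) ℝ).toBasis.linearIndependent.map'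
      (chartFrame m p).toLinearMap (LinearMap.ker_eq_bot.2 (chartFrame_injective p))
    convert! h using 2 with i
    simp
  obtain ⟨ρ', hρ', hdet⟩ := Metric.nhds_basis_ball.eventually_iff.1
    ((tendsto_metricMatrix_det (m := m) p).eventually_const_lt (half_lt_self hD0))
  set C := ‖chartFrame m p‖ with hC
  have hC0 : 0 ≤ C := ContinuousLinearMap.opNorm_nonneg _
  set K := 2 * (C + 1) with hK
  have hK0 : 0 < K := by positivity
  set V₁ := (volume (Metric.ball (0 : Em m) 1)).toReal with hV
  have hV0 : 0 < V₁ := ENNReal.toReal_pos (Metric.measure_ball_pos _ _ one_pos).ne'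
    measure_ball_lt_top.ne
  refine ⟨√(D / 2) * (K⁻¹ ^ m * V₁), by positivity, ?_⟩
  filter_upwards [self_mem_nhdsWithin, nhdsWithin_le_nhds (Iio_mem_nhds
    (show 0 < K * min ρ ρ' from mul_pos hK0 (lt_min hρ hρ')))] with r hr hrK
  replace hr : 0 < r := hr
  have hrK' : r / K < min ρ ρ' := (div_lt_iff₀' hK0).2 hrK
  refine le_trans ?_ (lintegral_metricMatrix_det_le_riemannianVolume p (Metric.ball p r))
  have hsub : Metric.ball (φ p) (r / K) ⊆ φ.symm ⁻¹' Metric.ball p r ∩ φ.target := by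
    intro y hy
    have hyρ : y ∈ Metric.closedBall (φ p) ρ := Metric.mem_closedBall.2
      ((Metric.mem_ball.1 hy).le.trans (hrK'.le.trans (min_le_left _ _)))
    refine ⟨?_, htar hyρ⟩
    have h1 := hdist y hyρ (φ p) (Metric.mem_closedBall_self hρ.le)
    rw [φ.left_inv (mem_extChartAt_source p)] at h1
    have h2 : ‖chartFrame m p (y - φ p)‖ ≤ C * dist y (φ p) := by
      rw [dist_eq_norm]; exact ContinuousLinearMap.le_opNorm _ _
    have h3 : dist y (φ p) * K < r := (lt_div_iff₀ hK0).1 (Metric.mem_ball.1 hy)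
    refine Metric.mem_ball.2 (lt_of_le_of_lt (h1.trans ?_) h3)
    rw [hK]
    nlinarith [dist_nonneg (x := y) (y := φ p)]
  calc ENNReal.ofReal (√(D / 2) * (K⁻¹ ^ m * V₁) * r ^ m)
      = ENNReal.ofReal √(D / 2) * volume (Metric.ball (φ p) (r / K)) := by
        rw [Measure.addHaar_ball_of_pos _ _ (by positivity), ← ENNReal.ofReal_toReal
          (measure_ball_lt_top (μ := volume) (x := (0 : Em m)) (r := 1)).ne, ← hV,
          finrank_euclideanSpace_fin, ← ENNReal.ofReal_mul (by positivity),
          ← ENNReal.ofReal_mul (by positivity), div_pow, inv_pow]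
        congr 1
        ring
    _ = ∫⁻ y in Metric.ball (φ p) (r / K), ENNReal.ofReal √(D / 2) := by
        rw [setLIntegral_const]
    _ ≤ ∫⁻ y in Metric.ball (φ p) (r / K),
          ENNReal.ofReal (Real.sqrt (metricMatrix m p y).det) := by
        refine setLIntegral_mono' measurableSet_ball fun y hy => ?_
        refine ENNReal.ofReal_le_ofReal (Real.sqrt_le_sqrt (hdet ?_).le)
        exact Metric.mem_ball.2
          ((Metric.mem_ball.1 hy).trans (hrK'.trans_le (min_le_right _ _)))
    _ ≤ _ := lintegral_mono_set hsub

end Volume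

/-! ### The extended integral -/

section ExtIntegral

variable {X : Type*} [MeasurableSpace X] {μ : Measure X}

theorem ofReal_add_add_ofReal_neg_add_ofReal_neg (a b : ℝ) :
    ENNReal.ofReal (a + b) + ENNReal.ofReal (-a) + ENNReal.ofReal (-b)
      = ENNReal.ofReal (-(a + b)) + ENNReal.ofReal a + ENNReal.ofReal b := by
  have h : ∀ x : ℝ, ENNReal.ofReal x = ENNReal.ofReal (max x 0) := fun x => by
    rcases le_total x 0 with hx | hx
    · rw [max_eq_right hx, ENNReal.ofReal_of_nonpos hx, ENNReal.ofReal_zero]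
    · rw [max_eq_left hx]
  have hpos : ∀ x : ℝ, 0 ≤ max x 0 := fun x => le_max_right _ _
  rw [h (a + b), h (-a), h (-b), h (-(a + b)), h a, h b,
    ← ENNReal.ofReal_add (hpos _) (hpos _), ← ENNReal.ofReal_add (add_nonneg (hpos _) (hpos _))
    (hpos _), ← ENNReal.ofReal_add (hpos _) (hpos _),
    ← ENNReal.ofReal_add (add_nonneg (hpos _) (hpos _)) (hpos _)]
  congr 1
  linarith [max_zero_sub_max_neg_zero_eq_self (a + b), max_zero_sub_max_neg_zero_eq_self a,
    max_zero_sub_max_neg_zero_eq_self b]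

/-- No integrability of `f` is needed: if `∫ f⁻ = ∞`, then both sides are `⊥`, also when
`∫ f⁺ = ∞`, because `x - ⊤ = ⊥` for every `x : EReal`. -/
theorem extIntegral_le_extIntegral_add {f g h : X → ℝ} (hf : AEMeasurable f μ)
    (hh : Integrable h μ) (hle : ∀ᵐ x ∂μ, g x ≤ f x + h x) :
    extIntegral μ g ≤ extIntegral μ f + ((∫ x, h x ∂μ : ℝ) : EReal) := by
  set P := ∫⁻ x, ENNReal.ofReal (f x) ∂μ with hP
  set N := ∫⁻ x, ENNReal.ofReal (-f x) ∂μ with hN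
  set P₁ := ∫⁻ x, ENNReal.ofReal (f x + h x) ∂μ with hP₁
  set N₁ := ∫⁻ x, ENNReal.ofReal (-(f x + h x)) ∂μ with hN₁
  set Hp := ∫⁻ x, ENNReal.ofReal (h x) ∂μ with hHp
  set Hn := ∫⁻ x, ENNReal.ofReal (-h x) ∂μ with hHn
  have hHp_top : Hp ≠ ⊤ := hh.lintegral_lt_top.ne
  have hHn_top : Hn ≠ ⊤ := hh.neg.lintegral_lt_top.ne
  have hint : ∫ x, h x ∂μ = Hp.toReal - Hn.toReal :=
    integral_eq_lintegral_pos_part_sub_lintegral_neg_part hh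
  have hmh := hh.aestronglyMeasurable.aemeasurable
  have hmadd : AEMeasurable (fun x => ENNReal.ofReal (f x + h x)) μ := (hf.add hmh).ennreal_ofReal
  have hmadd' : AEMeasurable (fun x => ENNReal.ofReal (-(f x + h x))) μ :=
    (hf.add hmh).neg.ennreal_ofReal
  have hmneg : AEMeasurable (fun x => ENNReal.ofReal (-h x)) μ := hmh.neg.ennreal_ofReal
  -- the pointwise identity `(f + h)⁺ + f⁻ + h⁻ = (f + h)⁻ + f⁺ + h⁺`, integrated
  have hid : P₁ + N + Hn = N₁ + P + Hp := by
    rw [hP₁, hN, hHn, hN₁, hP, hHp,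
      ← lintegral_add_left' hmadd, ← lintegral_add_right' _ hmneg, ← lintegral_add_left' hmadd',
      ← lintegral_add_right' _ hmh.ennreal_ofReal]
    refine lintegral_congr fun x => ?_
    exact ofReal_add_add_ofReal_neg_add_ofReal_neg (f x) (h x)
  have hmono : extIntegral μ g ≤ (P₁ : EReal) - (N₁ : EReal) := by
    refine EReal.sub_le_sub ?_ ?_
    · refine EReal.coe_ennreal_le_coe_ennreal_iff.2 (lintegral_mono_ae ?_)
      filter_upwards [hle] with x hx using ENNReal.ofReal_le_ofReal hx
    · refine EReal.coe_ennreal_le_coe_ennreal_iff.2 (lintegral_mono_ae ?_)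
      filter_upwards [hle] with x hx using ENNReal.ofReal_le_ofReal (neg_le_neg hx)
  refine hmono.trans ?_
  change _ ≤ (P : EReal) - (N : EReal) + _
  by_cases hNt : N = ⊤
  · have hN₁t : N₁ = ⊤ := by
      have h1 : N ≤ N₁ + Hp := by
        rw [hN, hN₁, hHp, ← lintegral_add_right' _ hmh.ennreal_ofReal]
        refine lintegral_mono fun x => ?_
        rw [show -f x = -(f x + h x) + h x by ring]
        exact ENNReal.ofReal_add_le
      rw [hNt, top_le_iff, ENNReal.add_eq_top] at h1
      exact h1.resolve_right hHp_top
    rw [hN₁t, EReal.coe_ennreal_top, EReal.sub_top]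
    exact bot_le
  by_cases hPt : P = ⊤
  · rw [hPt, EReal.coe_ennreal_top, ← EReal.coe_ennreal_toReal hNt, EReal.top_sub_coe,
      EReal.top_add_coe]
    exact le_top
  have hN₁t : N₁ ≠ ⊤ := by
    have h1 : N₁ ≤ N + Hn := by
      rw [hN, hN₁, hHn, ← lintegral_add_right' _ hmneg]
      refine lintegral_mono fun x => ?_
      rw [neg_add]
      exact ENNReal.ofReal_add_le
    exact ne_top_of_le_ne_top (ENNReal.add_ne_top.2 ⟨hNt, hHn_top⟩) h1
  have hP₁t : P₁ ≠ ⊤ := by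
    have h1 : P₁ + N + Hn ≠ ⊤ := hid ▸ (by finiteness)
    exact fun h => h1 (by simp [h])
  have hreal := congrArg ENNReal.toReal hid
  rw [ENNReal.toReal_add (by finiteness) (by finiteness), ENNReal.toReal_add (by finiteness)
    (by finiteness), ENNReal.toReal_add (by finiteness) (by finiteness),
    ENNReal.toReal_add (by finiteness) (by finiteness)] at hreal
  rw [← EReal.coe_ennreal_toReal hP₁t, ← EReal.coe_ennreal_toReal hN₁t,
    ← EReal.coe_ennreal_toReal hPt, ← EReal.coe_ennreal_toReal hNt, hint]
  norm_cast
  linarith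

theorem extIntegral_le_integral {g h : X → ℝ} (hh : Integrable h μ) (hle : ∀ᵐ x ∂μ, g x ≤ h x) :
    extIntegral μ g ≤ ((∫ x, h x ∂μ : ℝ) : EReal) := by
  have h0 : extIntegral μ (fun _ => (0 : ℝ)) = 0 := by simp [extIntegral]
  simpa [h0] using extIntegral_le_extIntegral_add (f := fun _ => (0 : ℝ)) aemeasurable_const hh
    (by simpa using hle)

end ExtIntegral

/-! ### Comparison of the two entropies -/

section Entropy

variable {m : ℕ} {M : Type*} [MetricSpace M] [ChartedSpace (Em m) M] [IsManifold (𝓡 m) ∞ M]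
    [RiemannianBundle (fun x : M => TangentSpace (𝓡 m) x)]
    [IsContinuousRiemannianBundle (Em m) (fun x : M => TangentSpace (𝓡 m) x)]
    [MeasurableSpace M] [BorelSpace M]

/-- The norm of the weak differential is measurable, being almost everywhere the limit of a
subsequence of the norms of the differentials of the approximating smooth functions. -/
theorem MemW012.aemeasurable_norm {Ω : Set M} {φ : M → ℝ}
    {dφ : (x : M) → (TangentSpace (𝓡 m) x →L[ℝ] ℝ)} (h : MemW012 m Ω φ dφ) :
    AEMeasurable (fun x => ‖dφ x‖) ((riemannianVolume m M).restrict Ω) := by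
  obtain ⟨-, ψ, hψ, hmeas, -, hlim⟩ := h
  have h1 := tendstoInMeasure_of_tendsto_eLpNorm (p := 2) (g := fun _ => (0 : ℝ)) two_ne_zero hmeas
    aestronglyMeasurable_const (l := atTop) (by
      refine hlim.congr fun k => ?_
      congr 1
      funext x
      simp)
  obtain ⟨ns, -, hns⟩ := h1.exists_seq_tendsto_ae
  refine aemeasurable_of_tendsto_metrizable_ae atTop
    (f := fun k x => ‖mvfderiv (𝓡 m) (ψ (ns k)) x‖)
    (fun k => (continuous_norm_mvfderiv (hψ (ns k)).1).measurable.aemeasurable) ?_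
  filter_upwards [hns] with x hx
  refine tendsto_iff_dist_tendsto_zero.2 (squeeze_zero (fun _ => dist_nonneg) (fun k => ?_) hx)
  rw [Real.dist_eq, abs_le]
  have e1 : ‖mvfderiv (𝓡 m) (ψ (ns k)) x‖
      ≤ ‖mvfderiv (𝓡 m) (ψ (ns k)) x - dφ x‖ + ‖dφ x‖ := by
    refine ContinuousLinearMap.opNorm_le_bound _ (add_nonneg (ContinuousLinearMap.opNorm_nonneg _)
      (ContinuousLinearMap.opNorm_nonneg _)) fun v => ?_
    have := norm_add_le ((mvfderiv (𝓡 m) (ψ (ns k)) x - dφ x) v) (dφ x v)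
    have e := (mvfderiv (𝓡 m) (ψ (ns k)) x - dφ x).le_opNorm v
    have e' := (dφ x).le_opNorm v
    rw [sub_apply, sub_add_cancel] at this
    rw [sub_apply] at e
    linarith
  have e2 : ‖dφ x‖ ≤ ‖mvfderiv (𝓡 m) (ψ (ns k)) x - dφ x‖
      + ‖mvfderiv (𝓡 m) (ψ (ns k)) x‖ := by
    refine ContinuousLinearMap.opNorm_le_bound _ (add_nonneg (ContinuousLinearMap.opNorm_nonneg _)
      (ContinuousLinearMap.opNorm_nonneg _)) fun v => ?_
    have := norm_sub_le (mvfderiv (𝓡 m) (ψ (ns k)) x v)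
      ((mvfderiv (𝓡 m) (ψ (ns k)) x - dφ x) v)
    have e := (mvfderiv (𝓡 m) (ψ (ns k)) x - dφ x).le_opNorm v
    have e' := (mvfderiv (𝓡 m) (ψ (ns k)) x).le_opNorm v
    rw [sub_apply, sub_sub_cancel] at this
    rw [sub_apply] at e
    linarith
  constructor <;> linarith

theorem WFunctional_le_of_le {Ω : Set M} (hΩ : MeasurableSet Ω) {a : M → ℝ} {Λ τ : ℝ}
    (hτ : 0 ≤ τ) (ha : ∀ x ∈ Ω, a x ≤ Λ) {φ : M → ℝ}
    {dφ : (x : M) → (TangentSpace (𝓡 m) x →L[ℝ] ℝ)} (h : Admissible m Ω φ dφ) :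
    WFunctional m a Ω φ dφ τ ≤ WFunctional m (fun _ => 0) Ω φ dφ τ + ((Λ * τ : ℝ) : EReal) := by
  obtain ⟨hW, -, hint⟩ := h
  have hmφ := hW.1.1.aemeasurable
  have hφ2 : Integrable (fun x => φ x ^ 2) ((riemannianVolume m M).restrict Ω) := by
    by_contra hcon
    rw [integral_undef hcon] at hint
    exact zero_ne_one hint
  have hf : AEMeasurable (fun x => τ * ((0 : ℝ) * (φ x) ^ 2 + 4 * ‖dφ x‖ ^ 2)
      - 2 * (φ x) ^ 2 * Real.log (φ x)) ((riemannianVolume m M).restrict Ω) :=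
    ((((hmφ.pow_const 2).const_mul 0).add ((hW.aemeasurable_norm.pow_const 2).const_mul 4)).const_mul
      τ).sub (((hmφ.pow_const 2).const_mul 2).mul (Real.measurable_log.comp_aemeasurable hmφ))
  have h1 := extIntegral_le_extIntegral_add (g := fun x => τ * (a x * (φ x) ^ 2 + 4 * ‖dφ x‖ ^ 2)
      - 2 * (φ x) ^ 2 * Real.log (φ x)) hf (hφ2.const_mul (Λ * τ)) (by
    filter_upwards [ae_restrict_mem hΩ] with x hx
    have : τ * (a x * φ x ^ 2) ≤ τ * (Λ * φ x ^ 2) := by gcongr; exact ha x hx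
    linarith)
  rw [integral_const_mul, hint, mul_one] at h1
  unfold WFunctional
  rw [add_assoc]
  exact add_le_add le_rfl h1

theorem nu_le_nuBar_add {Ω : Set M} (hΩ : MeasurableSet Ω) {Λ τ : ℝ} (hΛ : 0 ≤ Λ)
    (ha : ∀ x ∈ Ω, scalarCurvature m x ≤ Λ) :
    nu m Ω τ - ((Λ * τ : ℝ) : EReal) ≤ nuBar m Ω τ := by
  unfold nu nuBar nuFunctional muFunctional
  simp only [le_iInf_iff]
  intro s hs φ dφ h
  refine EReal.sub_le_of_le_add ?_
  refine ((iInf₂_le s hs).trans ((iInf_le _ φ).trans (iInf₂_le dφ h))).trans ?_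
  refine (WFunctional_le_of_le hΩ hs.1.le ha h).trans (add_le_add le_rfl ?_)
  exact EReal.coe_le_coe_iff.2 (mul_le_mul_of_nonneg_left hs.2 hΛ)

end Entropy

/-! ### The entropy bounds the volume ratio -/

/-- The tangent line inequality behind Jensen's inequality: for a density `q` of total mass `1` on a
set of volume `V`, integrating it bounds the entropy `-∫ q log q` by `log V`. -/
theorem neg_mul_log_le {q V : ℝ} (hq : 0 ≤ q) (hV : 0 < V) :
    -(q * Real.log q) ≤ q * (Real.log V - 1) + V⁻¹ := by
  rcases hq.eq_or_lt with rfl | hq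
  · simpa using hV.le
  have h := Real.one_sub_inv_le_log_of_pos (mul_pos hq hV)
  rw [Real.log_mul hq.ne' hV.ne', mul_inv] at h
  have h1 := mul_le_mul_of_nonneg_left h hq.le
  have h2 : q * (q⁻¹ * V⁻¹) = V⁻¹ := by rw [← mul_assoc, mul_inv_cancel₀ hq.ne', one_mul]
  linarith

section Upper

variable {m : ℕ} {M : Type*} [MetricSpace M] [ChartedSpace (Em m) M]
    [RiemannianBundle (fun x : M => TangentSpace (𝓡 m) x)]
    [MeasurableSpace M] [BorelSpace M]

/-- Smooth functions with compact support are their own approximating sequence in `W₀^{1,2}`. -/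
theorem admissible_of_contMDiff {Ω : Set M} {φ : M → ℝ} (hφ : ContMDiff (𝓡 m) 𝓘(ℝ, ℝ) ∞ φ)
    (hφ0 : ∀ x, 0 ≤ φ x) (hcpt : HasCompactSupport φ) (hsupp : tsupport φ ⊆ Ω)
    (hΩ : riemannianVolume m M Ω ≠ ⊤) (hint : ∫ x in Ω, (φ x) ^ 2 ∂(riemannianVolume m M) = 1) :
    Admissible m Ω φ (mvfderiv (𝓡 m) φ) := by
  have : IsFiniteMeasure ((riemannianVolume m M).restrict Ω) :=
    ⟨by rw [Measure.restrict_apply_univ]; exact hΩ.lt_top⟩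
  obtain ⟨C, hC⟩ := hcpt.exists_bound_of_continuous hφ.continuous
  have hz : ∀ x, ‖mvfderiv (𝓡 m) φ x - mvfderiv (𝓡 m) φ x‖ = 0 := fun x => by
    rw [sub_self]; exact ContinuousLinearMap.opNorm_zero
  refine ⟨⟨MemLp.of_bound hφ.continuous.measurable.aestronglyMeasurable C (ae_of_all _ hC),
    fun _ => φ, fun _ => ⟨hφ, hcpt, hsupp⟩, fun _ => ?_, ?_, ?_⟩, ae_of_all _ hφ0, hint⟩
  · simp only [hz]
    exact aestronglyMeasurable_const
  · simp
  · simp only [hz]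
    simp

/-- The entropy of a smooth cutoff function `f` supported in `U`, normalized in `L²`. The logarithmic
term is estimated by Jensen's inequality, in the form `neg_mul_log_le`. -/
theorem nuBar_le_of_contMDiff {Ω U : Set M} (hUΩ : U ⊆ Ω) (hU : MeasurableSet U)
    (hΩ : MeasurableSet Ω) (hfin : riemannianVolume m M Ω ≠ ⊤) {f : M → ℝ}
    (hf : ContMDiff (𝓡 m) 𝓘(ℝ, ℝ) ∞ f) (hf0 : ∀ x, 0 ≤ f x) (hcpt : HasCompactSupport f)
    (hsupp : tsupport f ⊆ U) {A I τ T : ℝ} (hA0 : 0 ≤ A) (hA : ∀ x, ‖mvfderiv (𝓡 m) f x‖ ≤ A)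
    (hI : ∫ x in U, (f x) ^ 2 ∂(riemannianVolume m M) = I) (hI0 : 0 < I) (hτ : τ ∈ Set.Ioc 0 T) :
    nuBar m Ω T ≤ ((-(m : ℝ) - (m : ℝ) / 2 * Real.log (4 * Real.pi * τ)
      + (4 * τ * A ^ 2 / I * (riemannianVolume m M).real U
        + Real.log ((riemannianVolume m M).real U)) : ℝ) : EReal) := by
  set μ := riemannianVolume m M with hμ
  have hUfin : μ U ≠ ⊤ := ne_top_of_le_ne_top hfin (measure_mono hUΩ)
  set V := μ.real U with hV
  have hV0 : 0 < V := by
    refine ENNReal.toReal_pos (fun h => hI0.ne' ?_) hUfin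
    rw [← hI, Measure.restrict_eq_zero.2 h, integral_zero_measure]
  have hN0 : 0 < √I := Real.sqrt_pos.2 hI0
  set φ : M → ℝ := fun x => (√I)⁻¹ * f x with hφ
  have hφs : ContMDiff (𝓡 m) 𝓘(ℝ, ℝ) ∞ φ := contMDiff_const.mul hf
  have hφsupp : tsupport φ ⊆ tsupport f := tsupport_mul_subset_right
  have hφout : ∀ x, x ∉ U → φ x = 0 := fun x hx =>
    image_eq_zero_of_notMem_tsupport fun h => hx (hsupp (hφsupp h))
  have hdφ : ∀ x, ‖mvfderiv (𝓡 m) φ x‖ ^ 2 ≤ A ^ 2 / I := by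
    intro x
    have h1 : ‖mvfderiv (𝓡 m) φ x‖ ≤ (√I)⁻¹ * A := by
      refine ContinuousLinearMap.opNorm_le_bound _ (by positivity) fun v => ?_
      have h2 : mvfderiv (𝓡 m) φ x v = (√I)⁻¹ * mvfderiv (𝓡 m) f x v := by
        rw [hφ, mvfderiv_fun_mul mdifferentiableAt_const (hf.mdifferentiableAt (by simp)),
          mvfderiv_const]
        change (√I)⁻¹ * mvfderiv (𝓡 m) f x v + f x * 0 = _
        ring
      rw [h2, norm_mul, Real.norm_of_nonneg (by positivity), mul_assoc]
      gcongr
      exact ContinuousLinearMap.le_of_opNorm_le _ (hA x) v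
    calc _ ≤ ((√I)⁻¹ * A) ^ 2 := by
          have := ContinuousLinearMap.opNorm_nonneg (mvfderiv (𝓡 m) φ x)
          gcongr
      _ = A ^ 2 / I := by rw [mul_pow, inv_pow, Real.sq_sqrt hI0.le]; ring
  have hdφout : ∀ x, x ∉ U → ‖mvfderiv (𝓡 m) φ x‖ = 0 := by
    intro x hx
    have h1 : φ =ᶠ[𝓝 x] fun _ => 0 :=
      notMem_tsupport_iff_eventuallyEq.1 fun h => hx (hsupp (hφsupp h))
    rw [mvfderiv_congr_of_eventuallyEq h1, mvfderiv_const]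
    exact ContinuousLinearMap.opNorm_zero
  have hint : ∫ x in Ω, (φ x) ^ 2 ∂μ = 1 := by
    rw [setIntegral_eq_of_subset_of_forall_sdiff_eq_zero (f := fun x => φ x ^ 2) hΩ hUΩ
      (fun x hx => by rw [hφout x hx.2]; simp)]
    simp only [hφ, mul_pow, inv_pow, Real.sq_sqrt hI0.le]
    rw [integral_const_mul, hI, inv_mul_cancel₀ hI0.ne']
  have hadm : Admissible m Ω φ (mvfderiv (𝓡 m) φ) := admissible_of_contMDiff hφs
    (fun x => mul_nonneg (by positivity) (hf0 x)) hcpt.mul_left ((hφsupp.trans hsupp).trans hUΩ)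
    hfin hint
  have hφ2 : Integrable (fun x => φ x ^ 2) (μ.restrict Ω) := by
    by_contra hcon
    rw [integral_undef hcon] at hint
    exact zero_ne_one hint
  unfold nuBar nuFunctional muFunctional
  refine ((iInf₂_le τ hτ).trans ((iInf_le _ φ).trans (iInf₂_le _ hadm))).trans ?_
  unfold WFunctional
  rw [EReal.coe_add]
  refine add_le_add le_rfl ?_
  set c := 4 * τ * A ^ 2 / I + V⁻¹ with hc
  have hind : Integrable (U.indicator fun _ => c) (μ.restrict Ω) := by
    rw [integrable_indicator_iff hU]
    exact integrableOn_const
      (ne_top_of_le_ne_top hUfin (Measure.restrict_apply_le _ _)) (by simp)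
  refine (extIntegral_le_integral
    (h := fun x => U.indicator (fun _ => c) x + φ x ^ 2 * (Real.log V - 1))
    (hind.add (hφ2.mul_const _)) (ae_of_all _ fun x => ?_)).trans ?_
  · by_cases hx : x ∈ U
    · rw [Set.indicator_of_mem hx]
      have h1 := neg_mul_log_le (sq_nonneg (φ x)) hV0
      rw [Real.log_pow] at h1
      have h2 : τ * (4 * ‖mvfderiv (𝓡 m) φ x‖ ^ 2) ≤ τ * (4 * (A ^ 2 / I)) := by
        gcongr
        · exact hτ.1.le
        · exact hdφ x
      rw [hc]
      push_cast at h1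
      have h3 : 4 * τ * A ^ 2 / I = τ * (4 * (A ^ 2 / I)) := by ring
      rw [h3]
      linarith
    · simp [Set.indicator_of_notMem hx, hφout x hx, hdφout x hx]
  · rw [EReal.coe_le_coe_iff, integral_add hind (hφ2.mul_const _), integral_mul_const, hint,
      integral_indicator hU, Measure.restrict_restrict hU, Set.inter_eq_left.2 hUΩ,
      setIntegral_const, smul_eq_mul, ← hV, hc, mul_add, mul_inv_cancel₀ hV0.ne']
    linarith

variable [IsManifold (𝓡 m) ∞ M]
    [IsContinuousRiemannianBundle (Em m) (fun x : M => TangentSpace (𝓡 m) x)]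
    [IsRiemannianManifold (𝓡 m) M] [CompleteSpace M]

/-- The entropy is bounded by the volume of a ball and the doubling ratio of the volume; the test
function is a smoothing of the tent function `max 0 (7 / 8 * r - dist · x₀)`. -/
theorem nuBar_le_log_volume_add {x₀ : M} {r r₀ : ℝ} (hr : 0 < r) (hrr : r ≤ r₀)
    (hfin : riemannianVolume m M (Metric.ball x₀ r₀) ≠ ⊤)
    (hpos : 0 < (riemannianVolume m M).real (Metric.ball x₀ (r / 2))) :
    nuBar m (Metric.ball x₀ r₀) (r₀ ^ 2) ≤
      ((-(m : ℝ) - (m : ℝ) / 2 * Real.log (4 * Real.pi * r ^ 2)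
      + (100 * ((riemannianVolume m M).real (Metric.ball x₀ r)
          / (riemannianVolume m M).real (Metric.ball x₀ (r / 2)))
        + Real.log ((riemannianVolume m M).real (Metric.ball x₀ r))) : ℝ) : EReal) := by
  have := properSpace_of_isRiemannianManifold m (M := M)
  set μ := riemannianVolume m M with hμ
  have hfinr : μ (Metric.ball x₀ r) ≠ ⊤ :=
    ne_top_of_le_ne_top hfin (measure_mono (Metric.ball_subset_ball hrr))
  obtain ⟨f, hf, hf0, hsupp, hfu, hA⟩ := exists_contMDiff_approx_of_lipschitz (m := m)
    (u := fun x => max 0 (7 / 8 * r - dist x x₀)) (x₀ := x₀) (s := 7 / 8 * r) (t := 15 / 16 * r)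
    (A := 5 / 4) (ε := r / 8) (fun x y => by
      rw [sub_le_iff_le_add]
      refine max_le (add_nonneg dist_nonneg (le_max_left _ _)) ?_
      have h1 := le_max_right 0 (7 / 8 * r - dist y x₀)
      linarith [dist_triangle y x x₀, dist_comm x y])
    (fun x => le_max_left _ _) (by linarith) (fun x hx => max_eq_left (by linarith))
    (by norm_num) (by positivity)
  have hcpt : HasCompactSupport f :=
    (isCompact_closedBall x₀ (15 / 16 * r)).of_isClosed_subset (isClosed_tsupport f) hsupp
  have hfin' : IsFiniteMeasure (μ.restrict (Metric.ball x₀ r)) :=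
    ⟨by rw [Measure.restrict_apply_univ]; exact hfinr.lt_top⟩
  obtain ⟨C, hC⟩ := hcpt.exists_bound_of_continuous hf.continuous
  have hf2 : IntegrableOn (fun x => f x ^ 2) (Metric.ball x₀ r) μ :=
    (MemLp.of_bound hf.continuous.measurable.aestronglyMeasurable C (ae_of_all _ hC)).integrable_sq
  have hI : (r / 4) ^ 2 * μ.real (Metric.ball x₀ (r / 2)) ≤ ∫ x in Metric.ball x₀ r, f x ^ 2 ∂μ := by
    have hsub : Metric.ball x₀ (r / 2) ⊆ Metric.ball x₀ r := Metric.ball_subset_ball (by linarith)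
    refine le_trans ?_ (setIntegral_mono_set hf2 (ae_of_all _ fun x => sq_nonneg (f x))
      (ae_of_all _ hsub))
    refine setIntegral_ge_of_const_le_real measurableSet_ball
      (ne_top_of_le_ne_top hfinr (measure_mono hsub)) (fun x hx => ?_) (hf2.mono_set hsub)
    have h1 := (abs_le.1 (hfu x)).1
    have h2 := le_max_right 0 (7 / 8 * r - dist x x₀)
    have h3 := Metric.mem_ball.1 hx
    have h4 : r / 4 ≤ f x := by linarith
    gcongr
  have hI0 : 0 < (r / 4) ^ 2 * μ.real (Metric.ball x₀ (r / 2)) := by positivity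
  refine (nuBar_le_of_contMDiff (Metric.ball_subset_ball hrr) measurableSet_ball measurableSet_ball
    hfin hf hf0 hcpt (hsupp.trans (Metric.closedBall_subset_ball (by linarith)))
    (by norm_num) hA rfl (hI0.trans_le hI)
    (τ := r ^ 2) ⟨by positivity, by gcongr⟩).trans ?_
  rw [EReal.coe_le_coe_iff]
  refine add_le_add le_rfl (add_le_add ?_ le_rfl)
  -- the gradient term: `|df| ≤ 5 / 4`, while `f ≥ r / 4` on the ball of radius `r / 2`
  calc 4 * r ^ 2 * (5 / 4) ^ 2 / (∫ x in Metric.ball x₀ r, f x ^ 2 ∂μ) * μ.real (Metric.ball x₀ r)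
      ≤ 4 * r ^ 2 * (5 / 4) ^ 2 / ((r / 4) ^ 2 * μ.real (Metric.ball x₀ (r / 2)))
          * μ.real (Metric.ball x₀ r) := by gcongr
    _ = _ := by field_simp; norm_num; ring

end Upper

/-- The unit ball lies in the cube `[-1, 1]^m`. -/
theorem omegaBall_toReal_le (m : ℕ) : (omegaBall m).toReal ≤ 2 ^ m := by
  have h : omegaBall m ≤ 2 ^ m := by
    calc omegaBall m ≤ volume ((WithLp.ofLp : Em m → Fin m → ℝ) ⁻¹'
          Set.pi Set.univ fun _ => Set.Icc (-1 : ℝ) 1) := by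
          refine measure_mono fun x hx i _ => ?_
          have h1 := PiLp.norm_apply_le x i
          rw [mem_ball_zero_iff] at hx
          exact abs_le.1 (h1.trans hx.le)
      _ = volume (Set.pi Set.univ fun _ : Fin m => Set.Icc (-1 : ℝ) 1) :=
          (PiLp.volume_preserving_ofLp (Fin m)).measure_preimage
            (MeasurableSet.univ_pi fun _ => measurableSet_Icc).nullMeasurableSet
      _ = 2 ^ m := by
          rw [volume_pi_pi]
          norm_num
  exact (ENNReal.toReal_mono (by finiteness) h).trans_eq (by simp)

section Final

variable {m : ℕ} {M : Type*} [MetricSpace M] [ChartedSpace (Em m) M] [IsManifold (𝓡 m) ∞ M]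
    [RiemannianBundle (fun x : M => TangentSpace (𝓡 m) x)]
    [IsContinuousRiemannianBundle (Em m) (fun x : M => TangentSpace (𝓡 m) x)]
    [IsRiemannianManifold (𝓡 m) M] [CompleteSpace M] [MeasurableSpace M] [BorelSpace M]

/-- If the entropy exceeds the logarithm of the volume ratio at `r₀` by more than `2 ^ (m + 7)`, the
volume doubling ratio at the radii `r₀ / 2 ^ k` is so large that the volume ratio decays
geometrically along these radii, whereas it is bounded below near the centre. -/
theorem le_log_volume_ratio_add {x₀ : M} {r₀ n : ℝ} (hr₀ : 0 < r₀)
    (hfin : riemannianVolume m M (Metric.ball x₀ r₀) ≠ ⊤)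
    (hn : (n : EReal) ≤ nuBar m (Metric.ball x₀ r₀) (r₀ ^ 2)) :
    Real.exp (n - 2 ^ (m + 7))
      ≤ (riemannianVolume m M).real (Metric.ball x₀ r₀) / ((omegaBall m).toReal * r₀ ^ m) := by
  set V : ℝ → ℝ := fun r => (riemannianVolume m M).real (Metric.ball x₀ r) with hV
  set w := (omegaBall m).toReal with hw
  have hw0 : 0 < w := ENNReal.toReal_pos (Metric.measure_ball_pos _ _ one_pos).ne'
    measure_ball_lt_top.ne
  obtain ⟨c, hc, hev⟩ := exists_eventually_le_riemannianVolume_ball (m := m) x₀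
  have hfin' : ∀ r ≤ r₀, riemannianVolume m M (Metric.ball x₀ r) ≠ ⊤ := fun r hr =>
    ne_top_of_le_ne_top hfin (measure_mono (Metric.ball_subset_ball hr))
  have hlow : ∀ᶠ r in 𝓝[>] (0 : ℝ), c * r ^ m ≤ V r := by
    filter_upwards [hev, nhdsWithin_le_nhds (Iio_mem_nhds hr₀)] with r hr hr'
    exact (ENNReal.ofReal_le_iff_le_toReal (hfin' r (le_of_lt hr'))).1 hr
  have hVpos : ∀ r, 0 < r → r ≤ r₀ → 0 < V r := by
    intro r hr hrr
    have hs_pos : ∀ᶠ s : ℝ in 𝓝[>] 0, 0 < s := self_mem_nhdsWithin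
    have hs_lt : ∀ᶠ s : ℝ in 𝓝[>] 0, s < r := nhdsWithin_le_nhds (Iio_mem_nhds hr)
    obtain ⟨s, hs, hs0, hsr⟩ := (hlow.and (hs_pos.and hs_lt)).exists
    exact (lt_of_lt_of_le (by positivity) hs).trans_le (ENNReal.toReal_mono (hfin' r hrr)
      (measure_mono (Metric.ball_subset_ball hsr.le)))
  by_contra! hcon
  set Q : ℝ → ℝ := fun r => V r / (w * r ^ m) with hQ
  have hQpos : ∀ r, 0 < r → r ≤ r₀ → 0 < Q r := fun r hr hrr =>
    div_pos (hVpos r hr hrr) (by positivity)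
  -- the test function bound in terms of the volume ratio
  have hkey : ∀ r, 0 < r → r ≤ r₀ → n ≤ 100 * (V r / V (r / 2)) + Real.log (Q r) := by
    intro r hr hrr
    have h1 := EReal.coe_le_coe_iff.1 (hn.trans (nuBar_le_log_volume_add hr hrr hfin
      (hVpos (r / 2) (by linarith) (by linarith))))
    have h2 : Real.log (Q r) = Real.log (V r) - (Real.log w + m * Real.log r) := by
      rw [hQ, Real.log_div (hVpos r hr hrr).ne' (by positivity),
        Real.log_mul hw0.ne' (by positivity), Real.log_pow]
    have h3 : Real.log (4 * Real.pi * r ^ 2)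
        = 2 * Real.log 2 + Real.log Real.pi + 2 * Real.log r := by
      rw [Real.log_mul (by positivity) (by positivity), Real.log_mul (by norm_num) (by positivity),
        Real.log_pow, show (4 : ℝ) = 2 ^ 2 by norm_num, Real.log_pow]
      push_cast
      ring
    have h4 : Real.log w ≤ m * Real.log 2 := by
      rw [← Real.log_pow]
      exact Real.log_le_log hw0 (omegaBall_toReal_le m)
    have h5 : 0 ≤ (m : ℝ) / 2 * Real.log Real.pi :=
      mul_nonneg (by positivity) (Real.log_nonneg (by linarith [Real.pi_gt_three]))
    have h6 : (0 : ℝ) ≤ m := by positivity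
    rw [h3] at h1
    rw [h2]
    linarith
  -- `Q r < exp (n - 2 ^ (m + 7))` forces `100 * (V r / V (r / 2)) > 2 ^ (m + 7) = 128 * 2 ^ m`
  have hstep : ∀ r, 0 < r → r ≤ r₀ → Q r < Real.exp (n - 2 ^ (m + 7)) →
      Q (r / 2) ≤ 100 / 128 * Q r := by
    intro r hr hrr hlt
    have h1 : Real.log (Q r) < n - 2 ^ (m + 7) := (Real.log_lt_iff_lt_exp (hQpos r hr hrr)).2 hlt
    have hV2 := hVpos (r / 2) (by linarith) (by linarith)
    have h2 : 2 ^ (m + 7) < 100 * (V r / V (r / 2)) := by linarith [hkey r hr hrr]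
    rw [← mul_div_assoc, lt_div_iff₀ hV2, pow_add] at h2
    have h3 : 2 ^ m * V (r / 2) ≤ 100 / 128 * V r := by linarith
    have h4 : Q (r / 2) = 2 ^ m * V (r / 2) / (w * r ^ m) := by
      simp only [hQ, div_pow]
      field_simp
    rw [h4, ← mul_div_assoc]
    gcongr
  have hdecay : ∀ k : ℕ, Q (r₀ / 2 ^ k) ≤ (100 / 128) ^ k * Q r₀ := by
    intro k
    induction k with
    | zero => simp
    | succ k ih =>
      have hk : r₀ / 2 ^ k ≤ r₀ := div_le_self hr₀.le (one_le_pow₀ one_le_two)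
      have h1 : Q (r₀ / 2 ^ k) ≤ Q r₀ := ih.trans
        (mul_le_of_le_one_left (hQpos r₀ hr₀ le_rfl).le (pow_le_one₀ (by norm_num) (by norm_num)))
      have h2 := hstep (r₀ / 2 ^ k) (by positivity) hk (h1.trans_lt hcon)
      rw [div_div, ← pow_succ] at h2
      refine h2.trans ?_
      rw [pow_succ' (100 / 128 : ℝ), mul_assoc]
      gcongr
  have hr_lim : Tendsto (fun k : ℕ => r₀ / 2 ^ k) atTop (𝓝[>] 0) := by
    refine tendsto_nhdsWithin_iff.2 ⟨?_, Eventually.of_forall fun k => ?_⟩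
    · exact tendsto_const_nhds.div_atTop (tendsto_pow_atTop_atTop_of_one_lt one_lt_two)
    · exact div_pos hr₀ (by positivity)
  have hQlow : ∀ᶠ k : ℕ in atTop, c / w ≤ (100 / 128) ^ k * Q r₀ := by
    filter_upwards [hr_lim.eventually hlow] with k hk
    refine le_trans ?_ (hdecay k)
    rw [hQ, div_le_div_iff₀ hw0 (by positivity)]
    nlinarith
  have hlim0 : Tendsto (fun k : ℕ => (100 / 128 : ℝ) ^ k * Q r₀) atTop (𝓝 (0 * Q r₀)) :=
    (tendsto_pow_atTop_nhds_zero_of_lt_one (by norm_num) (by norm_num)).mul_const _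
  rw [zero_mul] at hlim0
  exact absurd (ge_of_tendsto hlim0 hQlow) (not_le.2 (by positivity))

end Final

theorem mainTheorem11 (m : ℕ) {M : Type*} [MetricSpace M] [ChartedSpace (Em m) M]
    [IsManifold (𝓡 m) ∞ M] [RiemannianBundle (fun x : M => TangentSpace (𝓡 m) x)]
    [IsContMDiffRiemannianBundle (𝓡 m) ∞ (Em m) (fun x : M => TangentSpace (𝓡 m) x)]
    [IsRiemannianManifold (𝓡 m) M] [CompleteSpace M] [MeasurableSpace M] [BorelSpace M]
    (Ω : Set M) (Λbar : ℝ) (hΛ : 0 ≤ Λbar) (hR : ∀ x ∈ Ω, scalarCurvature m x ≤ Λbar)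
    (x₀ : M) (r₀ : ℝ) (hr₀ : 0 < r₀) (hB : Metric.ball x₀ r₀ ⊆ Ω) :
    EReal.exp (nuBar m (Metric.ball x₀ r₀) (r₀ ^ 2) - ((2 ^ (m + 7) : ℝ) : EReal))
        ≤ riemannianVolume m M (Metric.ball x₀ r₀) / (omegaBall m * ENNReal.ofReal (r₀ ^ m)) ∧
      EReal.exp (nu m (Metric.ball x₀ r₀) (r₀ ^ 2) - ((2 ^ (m + 7) : ℝ) : EReal)
          - ((Λbar * r₀ ^ 2 : ℝ) : EReal))
        ≤ EReal.exp (nuBar m (Metric.ball x₀ r₀) (r₀ ^ 2) - ((2 ^ (m + 7) : ℝ) : EReal)) := by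
  have := isContinuousRiemannianBundle_tangentSpace m M
  have hω0 : omegaBall m ≠ 0 := (Metric.measure_ball_pos _ _ one_pos).ne'
  have hωt : omegaBall m ≠ ⊤ := measure_ball_lt_top.ne
  refine ⟨?_, ?_⟩
  · by_cases hfin : riemannianVolume m M (Metric.ball x₀ r₀) = ⊤
    · rw [hfin, ENNReal.top_div_of_ne_top (by finiteness)]
      exact le_top
    have hratio : riemannianVolume m M (Metric.ball x₀ r₀) / (omegaBall m * ENNReal.ofReal (r₀ ^ m))
        = ENNReal.ofReal ((riemannianVolume m M).real (Metric.ball x₀ r₀)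
          / ((omegaBall m).toReal * r₀ ^ m)) := by
      have hw : 0 < (omegaBall m).toReal := ENNReal.toReal_pos hω0 hωt
      rw [ENNReal.ofReal_div_of_pos (by positivity), ENNReal.ofReal_mul hw.le,
        ENNReal.ofReal_toReal hωt, ofReal_measureReal hfin]
    rw [hratio]
    have hmain := fun n : ℝ => le_log_volume_ratio_add (n := n) hr₀ hfin
    revert hmain
    induction nuBar m (Metric.ball x₀ r₀) (r₀ ^ 2) using EReal.rec with
    | bot => intro _; simp
    | top =>
      intro hmain
      have h1 := hmain ((riemannianVolume m M).real (Metric.ball x₀ r₀)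
        / ((omegaBall m).toReal * r₀ ^ m) + 2 ^ (m + 7)) le_top
      rw [add_sub_cancel_right] at h1
      linarith [Real.add_one_le_exp ((riemannianVolume m M).real (Metric.ball x₀ r₀)
        / ((omegaBall m).toReal * r₀ ^ m))]
    | coe n =>
      intro hmain
      rw [← EReal.coe_sub, EReal.exp_coe]
      exact ENNReal.ofReal_le_ofReal (hmain n le_rfl)
  · refine EReal.exp_monotone ?_
    have h1 := nu_le_nuBar_add (m := m) (τ := r₀ ^ 2) (measurableSet_ball (x := x₀) (ε := r₀)) hΛ
      fun x hx => hR x (hB hx)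
    calc _ = nu m (Metric.ball x₀ r₀) (r₀ ^ 2) - ((Λbar * r₀ ^ 2 : ℝ) : EReal)
          - ((2 ^ (m + 7) : ℝ) : EReal) := by
          simp only [sub_eq_add_neg, add_right_comm]
      _ ≤ _ := EReal.sub_le_sub h1 le_rfl
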